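/- Let $n\ge 0$ and let $\mathcal M=\mathrm{Sym}_n^+$ be the manifold of real symmetric positive definite $n\times n$ matrices, with tangent spaces $\mathrm{Sym}_n$ and with identity element $I=I_n$. Equip $\mathcal M$ with one of the following Riemannian metrics ($u,v\in\mathrm{Sym}_n$, $P\in\mathcal M$): * (affine-invariant) $\langle u,v\rangle_P=\operatorname{tr}(P^{-1}uP^{-1}v)+\beta\operatorname{tr}(P^{-1}u)\operatorname{tr}(P^{-1}v)$ with $\beta\in\mathbb R$, $1+n\beta>0$; * (Log-Euclidean) $\langle u,v\rangle_P=\operatorname{tr}(D_P\log[u]\,D_P\log[v])$, where $\log$ is the matrix logarithm; * (Log-Cholesky) the pull-back of the metric $\langle X,Y\rangle_L=\sum_{j<i}X_{ij}Y_{ij}+\sum_j X_{jj}Y_{jj}L_{jj}^{-2}$ on lower triangular matrices with positive diagonal, under the map sending $P=LL^T$ to its Cholesky factor $L$. Let $\operatorname{Exp}$, $\operatorname{Log}$ be the Riemannian exponential and logarithmic maps, let $T_{P\to Q}$ be parallel transport along the geodesic from $P$ to $Q$, and put $$x\oplus y=\operatorname{Exp}_x\big(T_{I\to x}(\operatorname{Log}_I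 y)\big),\quad t\otimes x=\operatorname{Exp}_I(t\operatorname{Log}_I x),\quad \ominus x=\operatorname{Exp}_I(-\operatorname{Log}_I x),$$ $$\|x\|=\sqrt{\langle\operatorname{Log}_I x,\operatorname{Log}_I x\rangle_I},\quad d(x,y)=\|\ominus x\oplus y\|,\quad \phi_x(y)=\ominus x\oplus y .$$ Then $\phi_x(x)=I$ and $\phi_x$ is a bijection of $\mathcal M$ with inverse $\phi_x^{-1}(y)=x\oplus y$. For $x,y\in\mathcal M$ consider, for an unknown function $\alpha:[0,1]\to[0,1]$, the equation $$d\big(I,\alpha(t)\otimes\phi_x(y)\big)=t\,d\big(I,\phi_x(y)\big)\quad\text{for all }t\in[0,1].\qquad(\ast)$$ 1. The function $\alpha(t)=t$ solves $(\ast)$, and if $x\neq y$ it is the only solution. 2. For every solution $\alpha$ of $(\ast)$, the almost geodesic $\gamma_{x,y}(t)=\phi_x^{-1}(\alpha(t)\otimes\phi_x(y))$, $t\in[0,1]$, equals $x\oplus t\otimes(\ominus x\oplus y)$, and it is the Riemannian geodesic joining $x$ to $y$: it is a geodesic parametrized by $[0,1]$ from $x$ to $y$, and it is the only one. 3. Consequently,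 the proposed batch normalization layer on $\mathcal M$ (given a batch mean $m$, a running mean $m_r$, a bias $b$ and a momentum $\eta\in[0,1]$: centering $x\mapsto\phi_m(x)$, biasing $x\mapsto\phi_b^{-1}(x)$, running mean update $m_r\leftarrow\gamma_{m_r,m}(\eta)$) has the same three operations as the gyrogroup layer without scaling (centering $x\mapsto\ominus m\oplus x$, biasing $x\mapsto b\oplus x$, running mean updated to the point of parameter $\eta$ of the geodesic from $m_r$ to $m$). For each of the affine-invariant metrics it also has the same three operations as the SPD layer with centering $x\mapsto m^{-1/2}xm^{-1/2}$, biasing $x\mapsto b^{1/2}xb^{1/2}$ and running mean updated to the point of parameter $\eta$ of the geodesic from $m_r$ to $m$ for the affine-invariant metric with $\beta=0$. -/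

import Mathlib

open Set
open scoped unitInterval

noncomputable section

namespace SPDGyro

/-- Real `n × n` matrices. -/
abbrev Mat (n : ℕ) : Type := Matrix (Fin n) (Fin n) ℝ

/-- The manifold of symmetric positive definite matrices, an open subset of the space of symmetric
matrices; every tangent space is the space of symmetric matrices. -/
abbrev SPD (n : ℕ) : Type := {P : Mat n // P.PosDef}

instance (n : ℕ) : One (SPD n) := ⟨⟨1, Matrix.PosDef.one⟩⟩

instance (n : ℕ) : Nonempty (SPD n) := ⟨1⟩

/-! ### Riemannian geometry of `SPD n` in its global chart -/

/-- A (candidate) Riemannian metric: `g P u v` is the inner product at `P` of the tangent vectors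
`u` and `v`. Only its values at positive definite `P` and symmetric `u`, `v` matter. -/
abbrev Metric (n : ℕ) : Type := Mat n → Mat n → Mat n → ℝ

/-- The directional derivative of `f` at `P` in the direction `u`. -/
def dirDeriv {n : ℕ} {F : Type} [AddCommGroup F] [Module ℝ F] [TopologicalSpace F]
    (f : Mat n → F) (P u : Mat n) : F :=
  deriv (fun s : ℝ => f (P + s • u)) 0

/-- The Christoffel symbol of the first kind `⟨Γ_P(u, v), w⟩` of the Levi-Civita connection. -/
def christoffel {n : ℕ} (g : Metric n) (P u v w : Mat n) : ℝ :=
  (dirDeriv (fun Q => g Q v w) P u + dirDeriv (fun Q => g Q u w) P v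
    - dirDeriv (fun Q => g Q u v) P w) / 2

/-- A curve `[0,1] → SPD n`, extended to `ℝ` by constants and viewed in the space of matrices. -/
def extCurve {n : ℕ} (c : I → SPD n) : ℝ → Mat n :=
  Set.IccExtend zero_le_one (fun t : I => (c t : Mat n))

/-- The velocity of a curve; only its values on `[0,1]` matter, and they are one-sided derivatives
at the end points. -/
def velocity {n : ℕ} (c : I → SPD n) : ℝ → Mat n :=
  derivWithin (extCurve c) (Icc 0 1)

/-- `V` is a parallel vector field along the differentiable curve `c`: its covariant derivative,
tested against every tangent vector `w`, vanishes. -/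
def IsParallel {n : ℕ} (g : Metric n) (c : I → SPD n) (V : ℝ → Mat n) : Prop :=
  (∀ t ∈ Icc (0 : ℝ) 1, (V t).IsSymm) ∧ DifferentiableOn ℝ V (Icc 0 1) ∧
    ∀ t ∈ Icc (0 : ℝ) 1, ∀ w : Mat n, w.IsSymm →
      g (extCurve c t) (derivWithin V (Icc 0 1) t) w
        + christoffel g (extCurve c t) (velocity c t) (V t) w = 0

/-- `c` is a Riemannian geodesic (with affine parameter in `[0,1]`): its velocity is parallel. -/
def IsGeodesic {n : ℕ} (g : Metric n) (c : I → SPD n) : Prop :=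
  DifferentiableOn ℝ (extCurve c) (Icc 0 1) ∧ IsParallel g c (velocity c)

/-- `c` is a geodesic joining `P` to `Q`. -/
def IsGeodesicJoining {n : ℕ} (g : Metric n) (P Q : SPD n) (c : I → SPD n) : Prop :=
  IsGeodesic g c ∧ c 0 = P ∧ c 1 = Q

/-- The Riemannian exponential map: the end point of the geodesic issued from `P` with velocity
`v`. -/
def Exp {n : ℕ} (g : Metric n) (P : SPD n) (v : Mat n) : SPD n :=
  Classical.epsilon fun Q => ∃ c, IsGeodesicJoining g P Q c ∧ velocity c 0 = v

/-- The Riemannian logarithmic map: the initial velocity of the geodesic joining `P` to `Q`. -/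
def Log {n : ℕ} (g : Metric n) (P Q : SPD n) : Mat n :=
  Classical.epsilon fun v => ∃ c, IsGeodesicJoining g P Q c ∧ velocity c 0 = v

/-- Parallel transport of `v` along the geodesic joining `P` to `Q`. -/
def transport {n : ℕ} (g : Metric n) (P Q : SPD n) (v : Mat n) : Mat n :=
  Classical.epsilon fun w =>
    ∃ c V, IsGeodesicJoining g P Q c ∧ IsParallel g c V ∧ V 0 = v ∧ V 1 = w

/-- The value at `t` of the geodesic joining `P` to `Q`. -/
def geodesicPoint {n : ℕ} (g : Metric n) (P Q : SPD n) (t : I) : SPD n :=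
  (Classical.epsilon fun c => IsGeodesicJoining g P Q c) t

/-! ### The three geometries: affine-invariant, Log-Euclidean, Log-Cholesky -/

/-- The affine-invariant metrics
`⟨u, v⟩_P = tr(P⁻¹ u P⁻¹ v) + β tr(P⁻¹ u) tr(P⁻¹ v)`; positive definite iff `1 + n β > 0`. -/
def aiMetric {n : ℕ} (β : ℝ) : Metric n := fun P u v =>
  (P⁻¹ * u * P⁻¹ * v).trace + β * (P⁻¹ * u).trace * (P⁻¹ * v).trace

/-- The symmetric logarithm of a symmetric positive definite matrix (functional calculus). -/
def matLog {n : ℕ} (P : Mat n) : Mat n := cfc Real.log P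

/-- The Log-Euclidean metric `⟨u, v⟩_P = tr(D_P log[u] · D_P log[v])`. -/
def leMetric {n : ℕ} : Metric n := fun P u v =>
  (dirDeriv matLog P u * dirDeriv matLog P v).trace

/-- `L` is lower triangular with positive diagonal. -/
def IsCholeskyFactor {n : ℕ} (L : Mat n) : Prop :=
  (∀ i j, i < j → L i j = 0) ∧ ∀ i, 0 < L i i

/-- The Cholesky factor of a symmetric positive definite matrix. -/
def chol {n : ℕ} (P : Mat n) : Mat n :=
  Classical.epsilon fun L => IsCholeskyFactor L ∧ L * L.transpose = P

/-- The metric on the Cholesky space (lower triangular matrices with positive diagonal):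
`⟨X, Y⟩_L = ∑_{j < i} X_ij Y_ij + ∑_j X_jj Y_jj L_jj⁻²`. -/
def choleskySpaceMetric {n : ℕ} (L X Y : Mat n) : ℝ :=
  (∑ i, ∑ j, if j < i then X i j * Y i j else 0) + ∑ j, X j j * Y j j * ((L j j) ^ 2)⁻¹

/-- The Log-Cholesky metric: the pull-back of the metric of the Cholesky space under the Cholesky
map. -/
def lcMetric {n : ℕ} : Metric n := fun P u v =>
  choleskySpaceMetric (chol P) (dirDeriv chol P u) (dirDeriv chol P v)

/-- The metrics underlying the SPD gyrovector spaces. -/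
inductive IsGyroMetric {n : ℕ} : Metric n → Prop
  | ai (β : ℝ) (hβ : 0 < 1 + n * β) : IsGyroMetric (aiMetric β)
  | le : IsGyroMetric leMetric
  | lc : IsGyroMetric lcMetric

/-! ### Gyrovector space operations -/

/-- `P ⊕ Q = Exp_P (T_{1 → P} (Log_1 Q))`. -/
def gyroAdd {n : ℕ} (g : Metric n) (P Q : SPD n) : SPD n :=
  Exp g P (transport g 1 P (Log g 1 Q))

/-- `t ⊗ P = Exp_1 (t Log_1 P)`. -/
def gyroSmul {n : ℕ} (g : Metric n) (t : ℝ) (P : SPD n) : SPD n :=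
  Exp g 1 (t • Log g 1 P)

/-- `⊖ P = Exp_1 (- Log_1 P)`. -/
def gyroNeg {n : ℕ} (g : Metric n) (P : SPD n) : SPD n :=
  Exp g 1 (-Log g 1 P)

/-- The gyrolength `‖P‖ = √⟨Log_1 P, Log_1 P⟩_1`. -/
def gyroNorm {n : ℕ} (g : Metric n) (P : SPD n) : ℝ :=
  √(g (1 : Mat n) (Log g 1 P) (Log g 1 P))

/-- The gyrodistance `d(x, y) = ‖⊖ x ⊕ y‖`. -/
def gyroDist {n : ℕ} (g : Metric n) (x y : SPD n) : ℝ :=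
  gyroNorm g (gyroAdd g (gyroNeg g x) y)

/-- The left gyrotranslation `φ_x(y) = ⊖ x ⊕ y`. -/
def phi {n : ℕ} (g : Metric n) (x y : SPD n) : SPD n :=
  gyroAdd g (gyroNeg g x) y

/-- The inverse map of `φ_x`. -/
def phiInv {n : ℕ} (g : Metric n) (x : SPD n) : SPD n → SPD n :=
  Function.invFun (phi g x)

/-! ### Almost geodesics -/

/-- `α : [0,1] → [0,1]` solves `d(1, α(t) ⊗ φ_x(y)) = t d(1, φ_x(y))` for all `t ∈ [0,1]`. -/
def SolvesAlmostGeodesicEq {n : ℕ} (g : Metric n) (x y : SPD n) (α : I → I) : Prop :=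
  ∀ t : I, gyroDist g 1 (gyroSmul g (α t) (phi g x y)) = t * gyroDist g 1 (phi g x y)

/-- The curve `t ↦ φ_x⁻¹ (α(t) ⊗ φ_x(y))`, which is the almost geodesic joining `x` and `y` when `α`
solves the equation above. -/
def almostGeodesic {n : ℕ} (g : Metric n) (x y : SPD n) (α : I → I) : I → SPD n := fun t =>
  phiInv g x (gyroSmul g (α t) (phi g x y))

/-! ### Batch normalization (without scaling) -/

/-- The three operations from which a batch normalization layer without scaling is built, the
batch mean being given: `center m x` centers `x` by the mean `m`, `bias b x` adds the bias `b` to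
`x`, and `update m_r m_b η` is the new running mean. -/
@[ext] structure BNOps (M : Type) where
  center : M → M → M
  bias : M → M → M
  update : M → M → I → M

/-- The proposed layer: centering by `φ_m`, biasing by `φ_b⁻¹`, and update of the running mean along
the almost geodesic; `α` chooses, for each pair of points, a solution of the equation. -/
def proposedBN {n : ℕ} (g : Metric n) (α : SPD n → SPD n → I → I) : BNOps (SPD n) where
  center m x := phi g m x
  bias b x := phiInv g b x
  update m_r m_b η := almostGeodesic g m_r m_b (α m_r m_b) η

/-- The gyrogroup layer without scaling. -/
def gyroBN {n : ℕ} (g : Metric n) : BNOps (SPD n) where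
  center m x := gyroAdd g (gyroNeg g m) x
  bias b x := gyroAdd g b x
  update m_r m_b η := geodesicPoint g m_r m_b η

/-- The power `P ^ s` of a symmetric positive definite matrix (functional calculus). -/
def matPow {n : ℕ} (P : Mat n) (s : ℝ) : Mat n := cfc (fun a : ℝ => a ^ s) P

theorem matPow_congr_posDef {n : ℕ} (m x : SPD n) (s : ℝ) :
    (matPow (m : Mat n) s * (x : Mat n) * matPow (m : Mat n) s).PosDef := by
  have hsa : (matPow (m : Mat n) s).IsHermitian :=
    cfc_predicate (R := ℝ) (p := IsSelfAdjoint) (fun a : ℝ => a ^ s) (m : Mat n)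
  have hm : IsSelfAdjoint (m : Mat n) := m.2.isHermitian.isSelfAdjoint
  have hpos : ∀ a ∈ spectrum ℝ (m : Mat n), 0 < a := by
    intro a ha
    rw [m.2.isHermitian.spectrum_real_eq_range_eigenvalues] at ha
    obtain ⟨i, rfl⟩ := ha
    exact m.2.eigenvalues_pos i
  have hfin : ∀ f : ℝ → ℝ, ContinuousOn f (spectrum ℝ (m : Mat n)) := fun f =>
    (Matrix.finite_real_spectrum (A := (m : Mat n))).continuousOn f
  have hone : matPow (m : Mat n) (-s) * matPow (m : Mat n) s = 1 := by
    unfold matPow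
    rw [← cfc_mul _ _ _ (hfin _) (hfin _), ← cfc_one ℝ (m : Mat n)]
    refine cfc_congr fun a ha => ?_
    simp [← Real.rpow_add (hpos a ha)]
  have hinj : Function.Injective (matPow (m : Mat n) s).mulVec := by
    intro u v huv
    have := congrArg (matPow (m : Mat n) (-s)).mulVec huv
    simpa [Matrix.mulVec_mulVec, hone] using this
  have key := x.2.conjTranspose_mul_mul_same hinj
  rwa [hsa.eq] at key

/-- The congruence `x ↦ m ^ s · x · m ^ s`. -/
def spdCongr {n : ℕ} (m : SPD n) (s : ℝ) (x : SPD n) : SPD n :=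
  ⟨matPow (m : Mat n) s * (x : Mat n) * matPow (m : Mat n) s, matPow_congr_posDef m x s⟩

/-- The SPD layer of the affine-invariant geometry: centering `m^{-1/2} x m^{-1/2}`, biasing
`b^{1/2} x b^{1/2}`, and update of the running mean along the affine-invariant geodesic. -/
def affineBN {n : ℕ} : BNOps (SPD n) where
  center m x := spdCongr m (-(1 / 2)) x
  bias b x := spdCongr b (1 / 2) x
  update m_r m_b η := geodesicPoint (aiMetric 0) m_r m_b η

end SPDGyro

end

open Set
open scoped unitInterval Topology

noncomputable section

namespace SPDGyro

variable {n : ℕ}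

/-! ### A normed algebra structure on matrices -/

/-! In each geometry there are a vector space `W` and bijections `e P : W → SPD n` such that the
geodesics are exactly the curves `t ↦ e P (t • w)`, and the initial velocity at `1` of the ray of
`w` is transported to its initial velocity at `P`. This is the content of `ExpFrame`. It determines
every choice made in the definitions: `x ⊕ y = e x (log 1 y)`, `t ⊗ x = e 1 (t • log 1 x)` and `⊖ x
= e 1 (-log 1 x)`.

The theorem then becomes formal. Left cancellation shows that `φ_x` and `x ⊕ ·` are mutually
inverse. Since `⊖ 1 ⊕ P = P` and `‖t ⊗ P‖ = t ‖P‖` for `t ≥ 0`, the equation for `α` reads `α(t)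
‖φ_x(y)‖ = t ‖φ_x(y)‖`, with a nonzero norm exactly when `x ≠ y`. From `x ⊕ φ_x(y) = y` follows `log
1 (φ_x(y)) = log x y`, so the almost geodesic is the ray `e x (t • log x y)`.

The Log-Euclidean and Log-Cholesky metrics are pull-backs of the Frobenius product under a global
chart (`FlatChart`), where geodesics are straight segments and transport is trivial. For the
affine-invariant metrics the geodesic and transport equations do not involve `β` and are integrated
explicitly. There `e P w = P^{1/2} exp(w) P^{1/2}`, so that `x ⊕ y` is a congruence, which gives the
SPD layer. -/

instance matMetricSpace (n : ℕ) : MetricSpace (Mat n) :=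
  (Matrix.linftyOpNormedAddCommGroup : NormedAddCommGroup (Mat n)).toMetricSpace.replaceUniformity
    (U := Matrix.instUniformSpace (Fin n) (Fin n) ℝ) rfl

/-- The row-sum norm is submultiplicative, as a normed algebra requires. Its uniform structure is
the entrywise one by definition, so derivatives in the definitions of the geometry keep their
meaning. -/
instance matNormedRing (n : ℕ) : NormedRing (Mat n) :=
  { Matrix.instRing, matMetricSpace n with
    norm := (Matrix.linftyOpNormedAddCommGroup : NormedAddCommGroup (Mat n)).norm
    dist_eq := (Matrix.linftyOpNormedAddCommGroup : NormedAddCommGroup (Mat n)).dist_eq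
    norm_mul_le := Matrix.linfty_opNorm_mul }

instance matNormedAlgebra (n : ℕ) : NormedAlgebra ℝ (Mat n) :=
  { Matrix.instAlgebra with
    norm_smul_le := fun r x =>
      (Matrix.linftyOpNormedSpace (R := ℝ) : NormedSpace ℝ (Mat n)).norm_smul_le r x }

instance matComplete (n : ℕ) : CompleteSpace (Mat n) := FiniteDimensional.complete ℝ _

/-- The space of symmetric matrices. -/
def symSub (n : ℕ) : Submodule ℝ (Mat n) where
  carrier := {X | X.IsSymm}
  add_mem' := fun ha hb => Matrix.IsSymm.add ha hb
  zero_mem' := Matrix.isSymm_zero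
  smul_mem' := fun c _ hx => Matrix.IsSymm.smul hx c

theorem isSelfAdjoint_of_isSymm {X : Mat n} (h : X.IsSymm) : IsSelfAdjoint X := by
  change X.conjTranspose = X
  rw [Matrix.conjTranspose_eq_transpose_of_trivial]; exact h

theorem isSymm_of_isSelfAdjoint {X : Mat n} (h : IsSelfAdjoint X) : X.IsSymm := by
  have h' : X.conjTranspose = X := h
  rwa [Matrix.conjTranspose_eq_transpose_of_trivial] at h'

theorem isSymm_of_posDef {X : Mat n} (h : X.PosDef) : X.IsSymm :=
  isSymm_of_isSelfAdjoint h.isHermitian.isSelfAdjoint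

theorem isUnit_det_of_posDef {X : Mat n} (h : X.PosDef) : IsUnit X.det :=
  (Matrix.isUnit_iff_isUnit_det X).mp h.isUnit

/-! ### Calculus -/

theorem dirDeriv_eq_fderiv {F : Type} [NormedAddCommGroup F] [NormedSpace ℝ F] {f : Mat n → F}
    {P : Mat n} (h : DifferentiableAt ℝ f P) (u : Mat n) : dirDeriv f P u = fderiv ℝ f P u :=
  h.lineDeriv_eq_fderiv

theorem hasDerivAt_line (P u : Mat n) (t : ℝ) : HasDerivAt (fun s : ℝ => P + s • u) u t := by
  simpa using ((hasDerivAt_id t).smul_const u).const_add P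

theorem hasDerivAt_comp_line {F : Type} [NormedAddCommGroup F] [NormedSpace ℝ F] {f : Mat n → F}
    {P : Mat n} (h : DifferentiableAt ℝ f P) (u : Mat n) :
    HasDerivAt (fun s : ℝ => f (P + s • u)) (fderiv ℝ f P u) 0 :=
  h.hasFDerivAt.hasLineDerivAt u

theorem tendsto_line (P u : Mat n) : Filter.Tendsto (fun s : ℝ => P + s • u) (𝓝 0) (𝓝 P) := by
  have := (hasDerivAt_line P u 0).continuousAt.tendsto
  simpa using this

theorem hasDerivWithinAt_trace {f : ℝ → Mat n} {f' : Mat n} {s : Set ℝ} {t : ℝ}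
    (h : HasDerivWithinAt f f' s t) :
    HasDerivWithinAt (fun r => (f r).trace) f'.trace s t :=
  ((Matrix.traceLinearMap (Fin n) ℝ ℝ).toContinuousLinearMap).hasFDerivAt.comp_hasDerivWithinAt t h

theorem hasDerivWithinAt_transpose {f : ℝ → Mat n} {f' : Mat n} {s : Set ℝ} {t : ℝ}
    (h : HasDerivWithinAt f f' s t) :
    HasDerivWithinAt (fun r => (f r).transpose) f'.transpose s t :=
  ((Matrix.transposeLinearEquiv (Fin n) (Fin n) ℝ ℝ).toLinearMap.toContinuousLinearMap).hasFDerivAt.comp_hasDerivWithinAt t h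

theorem hasDerivWithinAt_inv {f : ℝ → Mat n} {f' : Mat n} {s : Set ℝ} {t : ℝ}
    (h : HasDerivWithinAt f f' s t) (hu : IsUnit (f t).det) :
    HasDerivWithinAt (fun r => (f r)⁻¹) (-((f t)⁻¹ * f' * (f t)⁻¹)) s t := by
  obtain ⟨u, hu⟩ := (Matrix.isUnit_iff_isUnit_det _).mpr hu
  have h1 := hasFDerivAt_ringInverse (𝕜 := ℝ) u
  rw [hu] at h1
  have h2 := h1.comp_hasDerivWithinAt t h
  have h3 : ((u⁻¹ : (Mat n)ˣ) : Mat n) = (f t)⁻¹ := by rw [← hu, Matrix.coe_units_inv]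
  simp only [h3] at h2
  have h4 : (fun r => (f r)⁻¹) = Ring.inverse ∘ f := by
    funext r; exact Matrix.nonsing_inv_eq_ringInverse (f r)
  rw [h4]
  exact h2

theorem hasDerivAt_trace {f : ℝ → Mat n} {f' : Mat n} {t : ℝ}
    (h : HasDerivAt f f' t) : HasDerivAt (fun r => (f r).trace) f'.trace t := by
  rw [← hasDerivWithinAt_univ] at *; exact hasDerivWithinAt_trace h

theorem hasDerivAt_transpose {f : ℝ → Mat n} {f' : Mat n} {t : ℝ}
    (h : HasDerivAt f f' t) : HasDerivAt (fun r => (f r).transpose) f'.transpose t := by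
  rw [← hasDerivWithinAt_univ] at *; exact hasDerivWithinAt_transpose h

theorem hasDerivAt_inv {f : ℝ → Mat n} {f' : Mat n} {t : ℝ}
    (h : HasDerivAt f f' t) (hu : IsUnit (f t).det) :
    HasDerivAt (fun r => (f r)⁻¹) (-((f t)⁻¹ * f' * (f t)⁻¹)) t := by
  rw [← hasDerivWithinAt_univ] at *; exact hasDerivWithinAt_inv h hu

/-- The derivative of a curve in a linear subspace lies in that subspace. -/
theorem mem_of_hasDerivWithinAt {W : Submodule ℝ (Mat n)} {f : ℝ → Mat n} {f' : Mat n}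
    {s : Set ℝ} {t : ℝ} (h : HasDerivWithinAt f f' s t) (hs : UniqueDiffWithinAt ℝ s t)
    (ht : f t ∈ W) (hW : ∀ᶠ r in 𝓝[s] t, f r ∈ W) : f' ∈ W := by
  have hcl : IsClosed (W : Set (Mat n)) := W.closed_of_finiteDimensional
  rw [hasDerivWithinAt_iff_tendsto_slope] at h
  have : (𝓝[s \ {t}] t).NeBot := by
    rw [uniqueDiffWithinAt_iff_accPt] at hs
    exact accPt_principal_iff_nhdsWithin.mp hs
  refine hcl.mem_of_tendsto h ?_
  filter_upwards [nhdsWithin_mono t sdiff_subset hW] with r hr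
  exact W.smul_mem _ (W.sub_mem hr ht)

theorem mem_of_hasDerivAt {W : Submodule ℝ (Mat n)} {f : ℝ → Mat n} {f' : Mat n}
    {t : ℝ} (h : HasDerivAt f f' t) (hW : ∀ᶠ r in 𝓝 t, f r ∈ W) : f' ∈ W :=
  mem_of_hasDerivWithinAt (hasDerivWithinAt_univ.mpr h) uniqueDiffWithinAt_univ hW.self_of_nhds
    (by rwa [nhdsWithin_univ])

/-- Geodesic and transport equations are all integrated below by exhibiting a constant of motion and
applying this. -/
theorem eq_of_hasDerivWithinAt_zero {f : ℝ → Mat n}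
    (h : ∀ t ∈ Icc (0 : ℝ) 1, HasDerivWithinAt f 0 (Icc 0 1) t) :
    ∀ t ∈ Icc (0 : ℝ) 1, f t = f 0 := by
  refine constant_of_derivWithin_zero (fun t ht => (h t ht).differentiableWithinAt) ?_
  intro t ht
  exact (h t (Ico_subset_Icc_self ht)).derivWithin
    (uniqueDiffOn_Icc zero_lt_one t (Ico_subset_Icc_self ht))

theorem uniqueDiff_I {t : ℝ} (ht : t ∈ Icc (0 : ℝ) 1) : UniqueDiffWithinAt ℝ (Icc (0 : ℝ) 1) t :=
  uniqueDiffOn_Icc zero_lt_one t ht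

/-! ### Curves -/

theorem extCurve_of_mem (c : I → SPD n) {t : ℝ} (ht : t ∈ Icc (0 : ℝ) 1) :
    extCurve c t = (c ⟨t, ht⟩ : Mat n) :=
  IccExtend_of_mem _ _ ht

theorem extCurve_posDef (c : I → SPD n) (t : ℝ) : (extCurve c t).PosDef :=
  (c (projIcc 0 1 zero_le_one t)).2

theorem extCurve_zero (c : I → SPD n) : extCurve c 0 = (c 0 : Mat n) :=
  extCurve_of_mem c ⟨le_refl 0, zero_le_one⟩

theorem extCurve_one (c : I → SPD n) : extCurve c 1 = (c 1 : Mat n) :=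
  extCurve_of_mem c ⟨zero_le_one, le_refl 1⟩

theorem zero_mem_I : (0 : ℝ) ∈ Icc (0 : ℝ) 1 := ⟨le_refl 0, zero_le_one⟩

theorem one_mem_I : (1 : ℝ) ∈ Icc (0 : ℝ) 1 := ⟨zero_le_one, le_refl 1⟩

theorem hasDerivWithinAt_extCurve {c : I → SPD n}
    (h : DifferentiableOn ℝ (extCurve c) (Icc 0 1)) {t : ℝ} (ht : t ∈ Icc (0 : ℝ) 1) :
    HasDerivWithinAt (extCurve c) (velocity c t) (Icc 0 1) t :=
  (h t ht).hasDerivWithinAt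

theorem velocity_isSymm {c : I → SPD n}
    (h : DifferentiableOn ℝ (extCurve c) (Icc 0 1)) {t : ℝ} (ht : t ∈ Icc (0 : ℝ) 1) :
    (velocity c t).IsSymm :=
  mem_of_hasDerivWithinAt (W := symSub n) (hasDerivWithinAt_extCurve h ht) (uniqueDiff_I ht)
    (isSymm_of_posDef (extCurve_posDef c t))
    (Filter.Eventually.of_forall fun r => isSymm_of_posDef (extCurve_posDef c r))

/-- `extCurve` is constant outside `[0,1]` and may have corners at the end points. An explicit
smooth formula `f` on all of `ℝ` supplies the one-sided derivatives. -/
theorem hasDerivWithinAt_extCurve_of_eq {c : I → SPD n} {f f' : ℝ → Mat n}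
    (hc : ∀ t : I, (c t : Mat n) = f t) (hf : ∀ t, HasDerivAt f (f' t) t) {t : ℝ}
    (ht : t ∈ Icc (0 : ℝ) 1) : HasDerivWithinAt (extCurve c) (f' t) (Icc 0 1) t := by
  have heq : EqOn (extCurve c) f (Icc 0 1) := fun s hs => by
    rw [extCurve_of_mem c hs]; exact hc ⟨s, hs⟩
  exact (hf t).hasDerivWithinAt.congr heq (heq ht)

theorem differentiableOn_extCurve_of_eq {c : I → SPD n} {f f' : ℝ → Mat n}
    (hc : ∀ t : I, (c t : Mat n) = f t) (hf : ∀ t, HasDerivAt f (f' t) t) :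
    DifferentiableOn ℝ (extCurve c) (Icc 0 1) :=
  fun _ ht => (hasDerivWithinAt_extCurve_of_eq hc hf ht).differentiableWithinAt

theorem velocity_of_eq {c : I → SPD n} {f f' : ℝ → Mat n}
    (hc : ∀ t : I, (c t : Mat n) = f t) (hf : ∀ t, HasDerivAt f (f' t) t) {t : ℝ}
    (ht : t ∈ Icc (0 : ℝ) 1) : velocity c t = f' t :=
  (hasDerivWithinAt_extCurve_of_eq hc hf ht).derivWithin (uniqueDiff_I ht)

theorem differentiableOn_velocity_of_eq {c : I → SPD n} {f f' : ℝ → Mat n}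
    (hc : ∀ t : I, (c t : Mat n) = f t) (hf : ∀ t, HasDerivAt f (f' t) t)
    (hf' : Differentiable ℝ f') : DifferentiableOn ℝ (velocity c) (Icc 0 1) :=
  hf'.differentiableOn.congr fun _ ht => velocity_of_eq hc hf ht

/-! ### Exponential, logarithm and powers -/

theorem exp_isSymm {X : Mat n} (h : X.IsSymm) : (NormedSpace.exp X).IsSymm := h.exp

theorem continuousOn_spectrum (f : ℝ → ℝ) (A : Mat n) : ContinuousOn f (spectrum ℝ A) :=
  (Matrix.finite_real_spectrum (A := A)).continuousOn f

theorem matLog_isSymm (P : Mat n) : (matLog P).IsSymm :=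
  isSymm_of_isSelfAdjoint (cfc_predicate (R := ℝ) (p := IsSelfAdjoint) Real.log P)

theorem matLog_exp {X : Mat n} (h : X.IsSymm) : matLog (NormedSpace.exp X) = X :=
  CFC.log_exp X (isSelfAdjoint_of_isSymm h)

theorem exp_half_mul_half (X : Mat n) :
    NormedSpace.exp ((1 / 2 : ℝ) • X) * NormedSpace.exp ((1 / 2 : ℝ) • X) = NormedSpace.exp X := by
  rw [← Matrix.exp_add_of_commute _ _ (Commute.refl _), ← add_smul]; norm_num

theorem exp_mul_exp_neg (X : Mat n) : NormedSpace.exp X * NormedSpace.exp (-X) = 1 := by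
  rw [← Matrix.exp_add_of_commute _ _ ((Commute.refl X).neg_right)]; simp

theorem exp_neg_mul_exp (X : Mat n) : NormedSpace.exp (-X) * NormedSpace.exp X = 1 := by
  simpa using exp_mul_exp_neg (-X)

theorem congr_posDef {R P : Mat n} (hR : R.IsSymm) (hu : IsUnit R) (hP : P.PosDef) :
    (R * P * R).PosDef := by
  have hinj : Function.Injective R.mulVec := Matrix.mulVec_injective_of_isUnit hu
  have key := hP.conjTranspose_mul_mul_same hinj
  rwa [Matrix.conjTranspose_eq_transpose_of_trivial, hR.eq] at key

theorem exp_posDef {X : Mat n} (h : X.IsSymm) : (NormedSpace.exp X).PosDef := by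
  have := congr_posDef (exp_isSymm (h.smul (1 / 2 : ℝ))) (Matrix.isUnit_exp _) Matrix.PosDef.one
  rwa [mul_one, exp_half_mul_half] at this

theorem exp_matLog {P : Mat n} (hP : P.PosDef) : NormedSpace.exp (matLog P) = P := by
  have hsa := hP.isHermitian.isSelfAdjoint
  have hpos : ∀ a ∈ spectrum ℝ P, 0 < a := by
    intro a ha
    rw [hP.isHermitian.spectrum_real_eq_range_eigenvalues] at ha
    obtain ⟨i, rfl⟩ := ha
    exact hP.eigenvalues_pos i
  rw [← CFC.real_exp_eq_normedSpace_exp (isSelfAdjoint_of_isSymm (matLog_isSymm P)), matLog,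
    ← cfc_comp' Real.exp Real.log P Real.continuous_exp.continuousOn (continuousOn_spectrum _ _)]
  conv_rhs => rw [← cfc_id' ℝ P]
  exact cfc_congr fun a ha => Real.exp_log (hpos a ha)

theorem matPow_exp {X : Mat n} (h : X.IsSymm) (s : ℝ) :
    matPow (NormedSpace.exp X) s = NormedSpace.exp (s • X) := by
  have hsa := isSelfAdjoint_of_isSymm h
  rw [matPow, ← CFC.real_exp_eq_normedSpace_exp hsa,
    ← CFC.real_exp_eq_normedSpace_exp (isSelfAdjoint_of_isSymm (h.smul s)),
    ← cfc_comp' (fun a : ℝ => a ^ s) Real.exp X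
      ((Matrix.finite_real_spectrum.image _).continuousOn _) (continuousOn_spectrum _ _),
    ← cfc_comp_smul s Real.exp X ((Matrix.finite_real_spectrum.image _).continuousOn _)]
  exact cfc_congr fun a _ => by simp [← Real.exp_mul, mul_comm]

theorem hasDerivAt_exp_smul (X : Mat n) (t : ℝ) :
    HasDerivAt (fun s : ℝ => NormedSpace.exp (s • X)) (NormedSpace.exp (t • X) * X) t :=
  hasDerivAt_exp_smul_const X t

theorem contDiff_matExp {k : WithTop ℕ∞} : ContDiff ℝ k (NormedSpace.exp : Mat n → Mat n) :=
  contDiff_iff_contDiffAt.mpr fun x =>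
    (NormedSpace.exp_analytic (𝕂 := ℝ) x).contDiffAt.of_le le_top

/-! ### Gyrovector operations in an exponential frame -/

/-- A description of the geometry of `g` in a parallel frame: `e P w` is the Riemannian exponential
at `P` of the tangent vector `τ P w`, and `τ P w` is the parallel transport of `τ 1 w` along the
geodesic from `1` to `P`. -/
structure ExpFrame (g : Metric n) {W : Type} [AddCommGroup W] [Module ℝ W]
    (e : SPD n → W → SPD n) (τ : SPD n → W → Mat n) : Prop where
  zero : ∀ P, e P 0 = P
  bij : ∀ P, Function.Bijective (e P)
  geod : ∀ P w, IsGeodesic g (fun t : I => e P ((t : ℝ) • w))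
  geod_eq : ∀ c, IsGeodesic g c → ∃ P w, c = fun t : I => e P ((t : ℝ) • w)
  vel : ∀ P w, velocity (fun t : I => e P ((t : ℝ) • w)) 0 = τ P w
  inj : ∀ P, Function.Injective (τ P)
  -- Existence of a parallel field here and uniqueness of its end value in `parallel_eq` together
  -- determine `transport`.
  parallel : ∀ w v, ∃ V, IsParallel g (fun t : I => e 1 ((t : ℝ) • w)) V ∧ V 0 = τ 1 v
  parallel_eq : ∀ w v V, IsParallel g (fun t : I => e 1 ((t : ℝ) • w)) V → V 0 = τ 1 v →
    V 1 = τ (e 1 w) v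
  smul : ∀ (s : ℝ) w, τ 1 (s • w) = s • τ 1 w
  metric_smul : ∀ (s : ℝ) u, g 1 (s • u) (s • u) = s ^ 2 * g 1 u u
  metric_pos : ∀ w, w ≠ 0 → 0 < g 1 (τ 1 w) (τ 1 w)
  -- Left cancellation `⊖ x ⊕ (x ⊕ y) = y` for `x = e 1 w`, `y = e 1 v` and `x ⊕ y = e 1 u`.
  cancel : ∀ w v u, e (e 1 w) v = e 1 u → e (e 1 (-w)) u = e 1 v

/-! ### Gyrovector calculus and almost geodesics in an exponential frame -/

namespace ExpFrame

variable {g : Metric n} {W : Type} [AddCommGroup W] [Module ℝ W]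
  {e : SPD n → W → SPD n} {τ : SPD n → W → Mat n}

/-- The inverse of `e P`. -/
def log (h : ExpFrame g e τ) (P Q : SPD n) : W := (Equiv.ofBijective (e P) (h.bij P)).symm Q

variable (h : ExpFrame g e τ)
include h

theorem e_log (P Q : SPD n) : e P (h.log P Q) = Q :=
  (Equiv.ofBijective (e P) (h.bij P)).apply_symm_apply Q

theorem log_e (P : SPD n) (w : W) : h.log P (e P w) = w :=
  (h.bij P).1 (h.e_log P _)

/-- Every geodesic is a ray; its value at `0` fixes the base point and injectivity of `e P` fixes
the direction. This existence and uniqueness makes the `Classical.epsilon` choices computable. -/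
theorem isGeodesicJoining_iff {P Q : SPD n} {c : I → SPD n} :
    IsGeodesicJoining g P Q c ↔ c = fun t : I => e P ((t : ℝ) • h.log P Q) := by
  constructor
  · rintro ⟨hc, h0, h1⟩
    obtain ⟨P', w, rfl⟩ := h.geod_eq c hc
    simp only [Icc.coe_zero, zero_smul, h.zero, Icc.coe_one, one_smul] at h0 h1
    subst h0 h1
    rw [h.log_e]
  · rintro rfl
    refine ⟨h.geod _ _, ?_, ?_⟩
    · simp [h.zero]
    · simp [h.e_log]

theorem Log_eq (P Q : SPD n) : Log g P Q = τ P (h.log P Q) := by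
  have spec : ∃ c, IsGeodesicJoining g P Q c ∧ velocity c 0 = Log g P Q :=
    Classical.epsilon_spec (p := fun v => ∃ c, IsGeodesicJoining g P Q c ∧ velocity c 0 = v)
      ⟨_, _, h.isGeodesicJoining_iff.mpr rfl, rfl⟩
  obtain ⟨c, hc, hv⟩ := spec
  rw [h.isGeodesicJoining_iff] at hc
  rw [hc, h.vel] at hv
  exact hv.symm

theorem Exp_eq (P : SPD n) (w : W) : Exp g P (τ P w) = e P w := by
  have spec : ∃ c, IsGeodesicJoining g P (Exp g P (τ P w)) c ∧ velocity c 0 = τ P w :=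
    Classical.epsilon_spec (p := fun Q => ∃ c, IsGeodesicJoining g P Q c ∧ velocity c 0 = τ P w)
      ⟨e P w, _, h.isGeodesicJoining_iff.mpr rfl, by rw [h.vel, h.log_e]⟩
  obtain ⟨c, hc, hv⟩ := spec
  rw [h.isGeodesicJoining_iff] at hc
  rw [hc, h.vel] at hv
  conv_rhs => rw [← h.inj P hv, h.e_log]

theorem transport_eq (P : SPD n) (v : W) : transport g 1 P (τ 1 v) = τ P v := by
  obtain ⟨V, hV, hV0⟩ := h.parallel (h.log 1 P) v
  obtain ⟨c, V', hc, hV', h0, h1⟩ := Classical.epsilon_spec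
    (p := fun u => ∃ c V, IsGeodesicJoining g 1 P c ∧ IsParallel g c V ∧ V 0 = τ 1 v ∧ V 1 = u)
    ⟨_, _, V, h.isGeodesicJoining_iff.mpr rfl, hV, hV0, rfl⟩
  rw [h.isGeodesicJoining_iff] at hc
  subst hc
  have := h.parallel_eq _ _ _ hV' h0
  rw [h.e_log] at this
  exact h1.symm.trans this

theorem geodesicPoint_eq (P Q : SPD n) (t : I) :
    geodesicPoint g P Q t = e P ((t : ℝ) • h.log P Q) := by
  have := Classical.epsilon_spec (p := fun c => IsGeodesicJoining g P Q c)
    ⟨_, h.isGeodesicJoining_iff.mpr rfl⟩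
  rw [h.isGeodesicJoining_iff] at this
  exact congrFun this t

theorem gyroAdd_eq (P Q : SPD n) : gyroAdd g P Q = e P (h.log 1 Q) := by
  rw [gyroAdd, h.Log_eq, h.transport_eq, h.Exp_eq]

theorem gyroSmul_eq (t : ℝ) (P : SPD n) : gyroSmul g t P = e 1 (t • h.log 1 P) := by
  rw [gyroSmul, h.Log_eq, ← h.smul, h.Exp_eq]

theorem gyroNeg_eq (P : SPD n) : gyroNeg g P = e 1 (-h.log 1 P) := by
  rw [gyroNeg, h.Log_eq, ← neg_one_smul ℝ, ← h.smul, h.Exp_eq, neg_one_smul]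

theorem phi_gyroAdd (x y : SPD n) : phi g x (gyroAdd g x y) = y := by
  have := h.cancel (h.log 1 x) (h.log 1 y) (h.log 1 (gyroAdd g x y))
    (by rw [h.e_log, h.e_log, h.gyroAdd_eq])
  rw [phi, h.gyroAdd_eq (gyroNeg g x), h.gyroNeg_eq, this, h.e_log]

/-- Left cancellation applied to `⊖ x` instead of `x`, using `- -w = w`. -/
theorem gyroAdd_phi (x y : SPD n) : gyroAdd g x (phi g x y) = y := by
  have := h.cancel (-h.log 1 x) (h.log 1 y) (h.log 1 (phi g x y))
    (by rw [h.e_log, phi, h.gyroAdd_eq, h.gyroNeg_eq])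
  rw [neg_neg, h.e_log, h.e_log] at this
  rw [h.gyroAdd_eq, this]

theorem phi_bijective (x : SPD n) : Function.Bijective (phi g x) :=
  Function.bijective_iff_has_inverse.mpr ⟨gyroAdd g x, h.gyroAdd_phi x, h.phi_gyroAdd x⟩

theorem phiInv_eq (x y : SPD n) : phiInv g x y = gyroAdd g x y := by
  have := Function.leftInverse_invFun (h.phi_bijective x).1 (gyroAdd g x y)
  rwa [h.phi_gyroAdd] at this

theorem log_self (P : SPD n) : h.log P P = 0 := by
  conv_lhs => rw [← h.zero P]
  rw [h.zero, ← h.log_e P 0, h.zero]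

theorem gyroAdd_one (x : SPD n) : gyroAdd g x 1 = x := by
  rw [h.gyroAdd_eq, h.log_self, h.zero]

theorem phi_self (x : SPD n) : phi g x x = 1 := by
  conv_lhs => rw [← h.gyroAdd_one x]
  rw [h.gyroAdd_one]
  exact (congrArg (phi g x) (h.gyroAdd_one x)).symm.trans (h.phi_gyroAdd x 1)

theorem gyroNorm_eq (P : SPD n) :
    gyroNorm g P = √(g 1 (τ 1 (h.log 1 P)) (τ 1 (h.log 1 P))) := by
  rw [gyroNorm, h.Log_eq]

theorem gyroNorm_pos {P : SPD n} (hP : P ≠ 1) : 0 < gyroNorm g P := by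
  rw [h.gyroNorm_eq]
  refine Real.sqrt_pos.mpr (h.metric_pos _ fun h0 => hP ?_)
  rw [← h.e_log 1 P, h0, h.zero]

theorem gyroNorm_smul {t : ℝ} (ht : 0 ≤ t) (P : SPD n) :
    gyroNorm g (gyroSmul g t P) = t * gyroNorm g P := by
  rw [h.gyroSmul_eq, h.gyroNorm_eq, h.log_e, h.smul, h.metric_smul, h.gyroNorm_eq,
    Real.sqrt_mul (sq_nonneg t), Real.sqrt_sq ht]

theorem gyroDist_one (P : SPD n) : gyroDist g 1 P = gyroNorm g P := by
  rw [gyroDist, h.gyroNeg_eq, h.log_self, neg_zero, h.zero, h.gyroAdd_eq, h.e_log]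

/-- The distance from `1` is the norm, and the norm is homogeneous for nonnegative scalars, so only
a scalar equation remains. -/
theorem solves_iff (x y : SPD n) (α : I → I) : SolvesAlmostGeodesicEq g x y α ↔
    ∀ t : I, (α t : ℝ) * gyroNorm g (phi g x y) = t * gyroNorm g (phi g x y) := by
  refine forall_congr' fun t => ?_
  rw [h.gyroDist_one, h.gyroDist_one, h.gyroNorm_smul (α t).2.1]

theorem solves_unique {x y : SPD n} (hxy : x ≠ y) {α : I → I}
    (hα : SolvesAlmostGeodesicEq g x y α) : α = fun t => t := by
  rw [h.solves_iff] at hα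
  have hne : phi g x y ≠ 1 := by
    intro h1
    have := h.gyroAdd_phi x y
    rw [h1, h.gyroAdd_one] at this
    exact hxy this
  funext t
  exact Subtype.ext (mul_right_cancel₀ (h.gyroNorm_pos hne).ne' (hα t))

/-- When `x = y` the function `α` is arbitrary, but `φ_x(x) = 1` is fixed by every scalar
multiplication. -/
theorem gyroSmul_phi {x y : SPD n} {α : I → I} (hα : SolvesAlmostGeodesicEq g x y α) (t : I) :
    gyroSmul g (α t) (phi g x y) = gyroSmul g t (phi g x y) := by
  by_cases hxy : x = y
  · subst hxy
    rw [h.phi_self, h.gyroSmul_eq, h.gyroSmul_eq, h.log_self, smul_zero, smul_zero]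
  · rw [h.solves_unique hxy hα]

theorem almostGeodesic_eq {x y : SPD n} {α : I → I} (hα : SolvesAlmostGeodesicEq g x y α)
    (t : I) : almostGeodesic g x y α t = gyroAdd g x (gyroSmul g t (phi g x y)) := by
  rw [almostGeodesic, h.phiInv_eq, h.gyroSmul_phi hα]

theorem almostGeodesic_eq' {x y : SPD n} {α : I → I} (hα : SolvesAlmostGeodesicEq g x y α) :
    almostGeodesic g x y α = fun t : I => e x ((t : ℝ) • h.log x y) := by
  funext t
  -- Both vectors are sent by `e x` to `x ⊕ φ_x(y) = y`.
  have h1 : h.log 1 (phi g x y) = h.log x y := by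
    apply (h.bij x).1
    rw [← h.gyroAdd_eq, h.gyroAdd_phi, h.e_log]
  rw [h.almostGeodesic_eq hα, h.gyroAdd_eq, h.gyroSmul_eq, h.log_e, h1]

theorem proposedBN_eq {α : SPD n → SPD n → I → I}
    (hα : ∀ x y : SPD n, SolvesAlmostGeodesicEq g x y (α x y)) : proposedBN g α = gyroBN g := by
  ext m x
  · rfl
  · simp only [proposedBN, gyroBN]
    rw [h.phiInv_eq]
  · simp only [proposedBN, gyroBN]
    rw [h.almostGeodesic_eq' (hα _ _), h.geodesicPoint_eq]

end ExpFrame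

/-! ### Second derivatives along curves -/

section SecondDerivative

variable {E F : Type} [NormedAddCommGroup E] [NormedSpace ℝ E] [NormedAddCommGroup F]
  [NormedSpace ℝ F]

/-- The second derivative as a function of two vectors. -/
def sndDeriv (f : E → F) (x u v : E) : F := fderiv ℝ (fderiv ℝ f) x u v

theorem sndDeriv_comm {f : E → F} {x : E} (hf : ContDiffAt ℝ 2 f x) (u v : E) :
    sndDeriv f x u v = sndDeriv f x v u :=
  (hf.isSymmSndFDerivAt (by simp)) u v

theorem hasDerivWithinAt_fderiv_apply {f : E → F} {k v : ℝ → E} {k' v' : E} {s : Set ℝ} {t : ℝ}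
    (hf : ContDiffAt ℝ 2 f (k t)) (hk : HasDerivWithinAt k k' s t)
    (hv : HasDerivWithinAt v v' s t) :
    HasDerivWithinAt (fun r => fderiv ℝ f (k r) (v r))
      (sndDeriv f (k t) k' (v t) + fderiv ℝ f (k t) v') s t :=
  (((hf.fderiv_right (m := 1) (by norm_num)).differentiableAt
    one_ne_zero).hasFDerivAt.comp_hasDerivWithinAt t hk).clm_apply hv

theorem hasDerivAt_fderiv_apply {f : E → F} {k : ℝ → E} {k' : E} {t : ℝ}
    (hf : ContDiffAt ℝ 2 f (k t)) (hk : HasDerivAt k k' t) (v : E) :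
    HasDerivAt (fun r => fderiv ℝ f (k r) v) (sndDeriv f (k t) k' v) t := by
  rw [← hasDerivWithinAt_univ] at *
  simpa using hasDerivWithinAt_fderiv_apply hf hk (hasDerivWithinAt_const t univ v)

end SecondDerivative

/-! ### Flat metrics: pull-backs of the Frobenius inner product under a global chart -/

/-- The Frobenius inner product. -/
def frob (X Y : Mat n) : ℝ := (X * Y.transpose).trace

theorem frob_add_left (X Y Z : Mat n) : frob (X + Y) Z = frob X Z + frob Y Z := by
  simp [frob, add_mul]

theorem frob_comm (X Y : Mat n) : frob X Y = frob Y X := by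
  rw [frob, frob, ← Matrix.trace_transpose, Matrix.transpose_mul, Matrix.transpose_transpose]

theorem frob_eq_sum (X Y : Mat n) : frob X Y = ∑ i, ∑ j, X i j * Y i j := by
  simp [frob, Matrix.trace, Matrix.mul_apply]

theorem frob_self_eq_zero {X : Mat n} (h : frob X X = 0) : X = 0 := by
  rw [frob_eq_sum] at h
  ext i j
  have h1 := (Finset.sum_eq_zero_iff_of_nonneg fun i _ =>
    Finset.sum_nonneg fun j _ => mul_self_nonneg (X i j)).mp h i (Finset.mem_univ i)
  have h2 := (Finset.sum_eq_zero_iff_of_nonneg fun j _ => mul_self_nonneg (X i j)).mp h1 j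
    (Finset.mem_univ j)
  exact mul_self_eq_zero.mp h2

theorem frob_self_nonneg (X : Mat n) : 0 ≤ frob X X := by
  rw [frob_eq_sum]
  exact Finset.sum_nonneg fun i _ => Finset.sum_nonneg fun j _ => mul_self_nonneg (X i j)

theorem frob_self_pos {X : Mat n} (h : X ≠ 0) : 0 < frob X X :=
  (frob_self_nonneg X).lt_of_ne fun h0 => h (frob_self_eq_zero h0.symm)

theorem hasDerivAt_frob {f k : ℝ → Mat n} {f' k' : Mat n} {t : ℝ} (hf : HasDerivAt f f' t)
    (hk : HasDerivAt k k' t) :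
    HasDerivAt (fun s => frob (f s) (k s)) (frob f' (k t) + frob (f t) k') t := by
  have := hasDerivAt_trace (hf.mul (hasDerivAt_transpose hk))
  rw [Matrix.trace_add] at this
  exact this

/-- `Φ` is a global chart of `SPD n` with values in the linear subspace `W` and inverse `Ψ`, and `g`
is the pull-back of the Frobenius inner product under `Φ`. -/
structure FlatChart (g : Metric n) (W : Submodule ℝ (Mat n)) (Φ Ψ : Mat n → Mat n) : Prop where
  mem : ∀ {P}, P.PosDef → Φ P ∈ W
  left_inv : ∀ {P}, P.PosDef → Ψ (Φ P) = P
  posDef : ∀ {X}, X ∈ W → (Ψ X).PosDef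
  right_inv : ∀ {X}, X ∈ W → Φ (Ψ X) = X
  one : Φ 1 = 0
  -- Openness among symmetric matrices allows differentiating, in symmetric directions, identities
  -- known only at positive definite points.
  nhds : ∀ {P : Mat n}, P.PosDef → ∀ᶠ Q in 𝓝 P, Q.IsSymm → Q.PosDef
  contDiff : ContDiff ℝ 2 Ψ
  contDiffAt : ∀ {P}, P.PosDef → ContDiffAt ℝ 2 Φ P
  metric : ∀ {P u v : Mat n}, P.PosDef → u.IsSymm → v.IsSymm →
    g P u v = frob (fderiv ℝ Φ P u) (fderiv ℝ Φ P v)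

namespace FlatChart

variable {g : Metric n} {W : Submodule ℝ (Mat n)} {Φ Ψ : Mat n → Mat n}

variable (h : FlatChart g W Φ Ψ)
include h

theorem diffAt {P : Mat n} (hP : P.PosDef) : DifferentiableAt ℝ Φ P :=
  (h.contDiffAt hP).differentiableAt two_ne_zero

theorem diff : Differentiable ℝ Ψ := h.contDiff.differentiable two_ne_zero

theorem nhds_line {P u : Mat n} (hP : P.PosDef) (hu : u.IsSymm) :
    ∀ᶠ s : ℝ in 𝓝 0, (P + s • u).PosDef := by
  filter_upwards [(tendsto_line P u).eventually (h.nhds hP)] with s hs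
  exact hs ((isSymm_of_posDef hP).add (hu.smul s))

theorem fderiv_mem {P u : Mat n} (hP : P.PosDef) (hu : u.IsSymm) : fderiv ℝ Φ P u ∈ W := by
  refine mem_of_hasDerivAt (hasDerivAt_comp_line (h.diffAt hP) u) ?_
  filter_upwards [h.nhds_line hP hu] with s hs
  exact h.mem hs

theorem fderiv_isSymm {X y : Mat n} (hX : X ∈ W) (hy : y ∈ W) : (fderiv ℝ Ψ X y).IsSymm := by
  refine mem_of_hasDerivAt (W := symSub n) (hasDerivAt_comp_line (h.diff X) y) ?_
  exact Filter.Eventually.of_forall fun s =>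
    isSymm_of_posDef (h.posDef (W.add_mem hX (W.smul_mem s hy)))

/-- The identity `Φ ∘ Ψ = id` is known on `W` only, so it is differentiated along lines inside `W`.
-/
theorem fderiv_fderiv {X y : Mat n} (hX : X ∈ W) (hy : y ∈ W) :
    fderiv ℝ Φ (Ψ X) (fderiv ℝ Ψ X y) = y := by
  have h1 := hasDerivAt_comp_line (h.diff X) y
  have h2 : HasFDerivAt Φ (fderiv ℝ Φ (Ψ X)) (Ψ (X + (0 : ℝ) • y)) := by
    rw [zero_smul, add_zero]; exact (h.diffAt (h.posDef hX)).hasFDerivAt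
  have h3 := h2.comp_hasDerivAt (0 : ℝ) h1
  have h4 : (Φ ∘ fun s : ℝ => Ψ (X + s • y)) = fun s => X + s • y := by
    funext s; exact h.right_inv (W.add_mem hX (W.smul_mem s hy))
  rw [h4] at h3
  exact h3.unique (hasDerivAt_line X y 0)

theorem fderiv_fderiv' {P u : Mat n} (hP : P.PosDef) (hu : u.IsSymm) :
    fderiv ℝ Ψ (Φ P) (fderiv ℝ Φ P u) = u := by
  have h1 := hasDerivAt_comp_line (h.diffAt hP) u
  have h2 : HasFDerivAt Ψ (fderiv ℝ Ψ (Φ P)) (Φ (P + (0 : ℝ) • u)) := by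
    rw [zero_smul, add_zero]; exact (h.diff _).hasFDerivAt
  have h3 := h2.comp_hasDerivAt (0 : ℝ) h1
  refine h3.unique ((hasDerivAt_line P u 0).congr_of_eventuallyEq ?_)
  filter_upwards [h.nhds_line hP hu] with s hs
  exact h.left_inv hs

theorem dirDeriv_metric {P u a b : Mat n} (hP : P.PosDef) (hu : u.IsSymm) (ha : a.IsSymm)
    (hb : b.IsSymm) : dirDeriv (fun Q => g Q a b) P u =
      frob (sndDeriv Φ P u a) (fderiv ℝ Φ P b)
        + frob (fderiv ℝ Φ P a) (sndDeriv Φ P u b) := by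
  have h1 : ∀ c : Mat n, HasDerivAt (fun s : ℝ => fderiv ℝ Φ (P + s • u) c)
      (sndDeriv Φ P u c) 0 := fun c => by
    have hc : ContDiffAt ℝ 2 Φ (P + (0 : ℝ) • u) := by
      rw [zero_smul, add_zero]; exact h.contDiffAt hP
    simpa using hasDerivAt_fderiv_apply hc (hasDerivAt_line P u 0) c
  have h2 := hasDerivAt_frob (h1 a) (h1 b)
  rw [zero_smul, add_zero] at h2
  refine (h2.congr_of_eventuallyEq ?_).deriv
  filter_upwards [h.nhds_line hP hu] with s hs
  exact h.metric hs ha hb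

/-- By the Leibniz rule the three directional derivatives give six products; symmetry of the second
derivative cancels four and identifies the other two. -/
theorem christoffel_eq {P u v w : Mat n} (hP : P.PosDef) (hu : u.IsSymm) (hv : v.IsSymm)
    (hw : w.IsSymm) : christoffel g P u v w =
      frob (sndDeriv Φ P u v) (fderiv ℝ Φ P w) := by
  have hs := sndDeriv_comm (h.contDiffAt hP)
  rw [christoffel, h.dirDeriv_metric hP hu hv hw, h.dirDeriv_metric hP hv hu hw,
    h.dirDeriv_metric hP hw hu hv, hs v u, hs w u, hs w v,
    frob_comm (sndDeriv Φ P u w)]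
  ring

theorem hasDerivWithinAt_fderiv {c : I → SPD n} {V : ℝ → Mat n}
    (hc : DifferentiableOn ℝ (extCurve c) (Icc 0 1)) (hV : DifferentiableOn ℝ V (Icc 0 1)) {t : ℝ}
    (ht : t ∈ Icc (0 : ℝ) 1) :
    HasDerivWithinAt (fun s => fderiv ℝ Φ (extCurve c s) (V s))
      (sndDeriv Φ (extCurve c t) (velocity c t) (V t)
        + fderiv ℝ Φ (extCurve c t) (derivWithin V (Icc 0 1) t)) (Icc 0 1) t :=
  hasDerivWithinAt_fderiv_apply (h.contDiffAt (extCurve_posDef c t))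
    (hasDerivWithinAt_extCurve hc ht) (hV t ht).hasDerivWithinAt

/-- In the chart the covariant derivative is the ordinary derivative of `DΦ(V)`, so parallel fields
are those with constant coordinates. -/
theorem isParallel_iff {c : I → SPD n} {V : ℝ → Mat n}
    (hc : DifferentiableOn ℝ (extCurve c) (Icc 0 1)) (hV : DifferentiableOn ℝ V (Icc 0 1))
    (hs : ∀ t ∈ Icc (0 : ℝ) 1, (V t).IsSymm) :
    IsParallel g c V ↔ ∀ t ∈ Icc (0 : ℝ) 1,
      fderiv ℝ Φ (extCurve c t) (V t) = fderiv ℝ Φ (extCurve c 0) (V 0) := by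
  have hs' : ∀ t ∈ Icc (0 : ℝ) 1, (derivWithin V (Icc 0 1) t).IsSymm := fun t ht =>
    mem_of_hasDerivWithinAt (W := symSub n) (hV t ht).hasDerivWithinAt (uniqueDiff_I ht)
      (hs t ht) (eventually_mem_nhdsWithin.mono hs)
  have key : ∀ t ∈ Icc (0 : ℝ) 1, ∀ w : Mat n, w.IsSymm →
      g (extCurve c t) (derivWithin V (Icc 0 1) t) w
        + christoffel g (extCurve c t) (velocity c t) (V t) w =
      frob (sndDeriv Φ (extCurve c t) (velocity c t) (V t)
        + fderiv ℝ Φ (extCurve c t) (derivWithin V (Icc 0 1) t))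
        (fderiv ℝ Φ (extCurve c t) w) := by
    intro t ht w hw
    rw [h.metric (extCurve_posDef c t) (hs' t ht) hw,
      h.christoffel_eq (extCurve_posDef c t) (velocity_isSymm hc ht) (hs t ht) hw, frob_add_left,
      add_comm]
  constructor
  · rintro ⟨-, -, hp⟩
    refine eq_of_hasDerivWithinAt_zero (f := fun t => fderiv ℝ Φ (extCurve c t) (V t))
      fun t ht => ?_
    have hd := h.hasDerivWithinAt_fderiv hc hV ht
    have hmem := mem_of_hasDerivWithinAt (W := W) hd (uniqueDiff_I ht)
      (h.fderiv_mem (extCurve_posDef c t) (hs t ht))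
      (eventually_mem_nhdsWithin.mono fun r hr => h.fderiv_mem (extCurve_posDef c r) (hs r hr))
    -- The test vector is the one whose image under `DΦ` is the derivative itself, so the tested
    -- equation says that its Frobenius norm vanishes.
    have hz := hp t ht _ (h.fderiv_isSymm (h.mem (extCurve_posDef c t)) hmem)
    have hX := h.fderiv_fderiv (h.mem (extCurve_posDef c t)) hmem
    rw [h.left_inv (extCurve_posDef c t)] at hX
    rw [key t ht _ (h.fderiv_isSymm (h.mem (extCurve_posDef c t)) hmem), hX] at hz
    rwa [frob_self_eq_zero hz] at hd
  · intro hconst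
    refine ⟨hs, hV, fun t ht w hw => ?_⟩
    have hd := h.hasDerivWithinAt_fderiv hc hV ht
    have hd0 := (hasDerivWithinAt_const t (Icc (0 : ℝ) 1)
      (fderiv ℝ Φ (extCurve c 0) (V 0))).congr hconst (hconst t ht)
    rw [key t ht w hw, (uniqueDiff_I ht).eq_deriv _ hd hd0]
    simp [frob]

/-- The exponential map of a flat metric. -/
def exp (P : SPD n) (w : W) : SPD n := ⟨Ψ (Φ P + w), h.posDef (W.add_mem (h.mem P.2) w.2)⟩

theorem coe_exp (P : SPD n) (w : W) : (h.exp P w : Mat n) = Ψ (Φ P + w) := rfl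

theorem chart_exp (P : SPD n) (w : W) : Φ (h.exp P w) = Φ P + w :=
  h.right_inv (W.add_mem (h.mem P.2) w.2)

theorem hasDerivAt_ray (X y : Mat n) (t : ℝ) :
    HasDerivAt (fun s : ℝ => Ψ (X + s • y)) (fderiv ℝ Ψ (X + t • y) y) t :=
  (h.diff (X + t • y)).hasFDerivAt.comp_hasDerivAt t (hasDerivAt_line X y t)

theorem differentiable_fderiv_ray (X y z : Mat n) :
    Differentiable ℝ fun s : ℝ => fderiv ℝ Ψ (X + s • y) z := fun t =>
  (hasDerivAt_fderiv_apply h.contDiff.contDiffAt (hasDerivAt_line X y t) z).differentiableAt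

theorem exp_ray (P : SPD n) (w : W) (t : I) :
    (h.exp P ((t : ℝ) • w) : Mat n) = Ψ (Φ P + (t : ℝ) • (w : Mat n)) := rfl

theorem isParallel_ray (P : SPD n) (w v : W) :
    IsParallel g (fun t : I => h.exp P ((t : ℝ) • w))
      (fun t => fderiv ℝ Ψ (Φ P + t • (w : Mat n)) v) := by
  have hm : ∀ t : ℝ, Φ P + t • (w : Mat n) ∈ W :=
    fun t => W.add_mem (h.mem P.2) (W.smul_mem t w.2)
  rw [h.isParallel_iff
    (differentiableOn_extCurve_of_eq (h.exp_ray P w) (h.hasDerivAt_ray (Φ P) w))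
    (h.differentiable_fderiv_ray _ _ _).differentiableOn
    (fun t _ => h.fderiv_isSymm (hm t) v.2)]
  have hkey : ∀ t ∈ Icc (0 : ℝ) 1, fderiv ℝ Φ (extCurve (fun t : I => h.exp P ((t : ℝ) • w)) t)
      (fderiv ℝ Ψ (Φ P + t • (w : Mat n)) v) = v := by
    intro t ht
    rw [extCurve_of_mem _ ht]
    exact h.fderiv_fderiv (hm t) v.2
  intro t ht
  rw [hkey t ht, hkey 0 zero_mem_I]

theorem isGeodesic_ray (P : SPD n) (w : W) :
    IsGeodesic g (fun t : I => h.exp P ((t : ℝ) • w)) := by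
  have hd := differentiableOn_extCurve_of_eq (h.exp_ray P w) (h.hasDerivAt_ray (Φ P) w)
  have hv : ∀ t ∈ Icc (0 : ℝ) 1, velocity (fun t : I => h.exp P ((t : ℝ) • w)) t =
      fderiv ℝ Ψ (Φ P + t • (w : Mat n)) w :=
    fun t ht => velocity_of_eq (h.exp_ray P w) (h.hasDerivAt_ray (Φ P) w) ht
  obtain ⟨h1, h2, h3⟩ := h.isParallel_ray P w w
  refine ⟨hd, ⟨fun t ht => velocity_isSymm hd ht, h2.congr hv, fun t ht u hu => ?_⟩⟩
  have h4 := h3 t ht u hu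
  rw [← derivWithin_congr hv (hv t ht)] at h4
  beta_reduce at h4
  rwa [← hv t ht] at h4

/-- A parallel velocity has constant coordinates `y`, so `Φ ∘ c` minus `t • y` is constant. -/
theorem eq_ray {c : I → SPD n} (hc : IsGeodesic g c) :
    ∃ P w, c = fun t : I => h.exp P ((t : ℝ) • w) := by
  obtain ⟨hd, hp⟩ := hc
  have hconst := (h.isParallel_iff hd hp.2.1 hp.1).mp hp
  have hmem := h.fderiv_mem (extCurve_posDef c 0) (hp.1 0 zero_mem_I)
  set y := fderiv ℝ Φ (extCurve c 0) (velocity c 0) with hy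
  have hder : ∀ t ∈ Icc (0 : ℝ) 1,
      HasDerivWithinAt (fun t : ℝ => Φ (extCurve c t) - t • y) 0 (Icc 0 1) t := by
    intro t ht
    have h1 := (h.diffAt (extCurve_posDef c t)).hasFDerivAt.comp_hasDerivWithinAt t
      (hasDerivWithinAt_extCurve hd ht)
    rw [hconst t ht] at h1
    have h2 := h1.sub ((hasDerivWithinAt_id t (Icc (0 : ℝ) 1)).smul_const y)
    rw [one_smul, sub_self] at h2
    exact h2
  have hlin := eq_of_hasDerivWithinAt_zero hder
  refine ⟨c 0, ⟨y, hmem⟩, funext fun t => Subtype.ext ?_⟩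
  have ht := hlin t t.2
  rw [zero_smul, sub_zero, sub_eq_iff_eq_add, extCurve_zero, extCurve_of_mem c t.2] at ht
  rw [h.exp_ray, ← ht]
  exact (h.left_inv (c t).2).symm

theorem metric_one (u : W) :
    g 1 (fderiv ℝ Ψ 0 u) (fderiv ℝ Ψ 0 u) = frob (u : Mat n) u := by
  have h0 : Ψ 0 = 1 := by rw [← h.one, h.left_inv Matrix.PosDef.one]
  have hs := h.fderiv_isSymm W.zero_mem u.2
  have := h.fderiv_fderiv W.zero_mem u.2
  rw [h0] at this
  rw [h.metric Matrix.PosDef.one hs hs, this]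

/-- Homogeneity is a separate hypothesis because `ExpFrame` asks it for all matrices `u`, while the
pull-back formula covers symmetric ones only. -/
theorem expFrame (hsmul : ∀ (s : ℝ) (u : Mat n), g 1 (s • u) (s • u) = s ^ 2 * g 1 u u) :
    ExpFrame g h.exp (fun P w => fderiv ℝ Ψ (Φ P) (w : Mat n)) where
  zero P := Subtype.ext (by rw [h.coe_exp]; simp [h.left_inv P.2])
  bij P := by
    constructor
    · intro w v hwv
      have := congrArg (fun Q : SPD n => Φ Q) hwv
      simp only [h.chart_exp] at this
      exact Subtype.ext (add_left_cancel this)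
    · intro Q
      refine ⟨⟨Φ Q - Φ P, W.sub_mem (h.mem Q.2) (h.mem P.2)⟩, Subtype.ext ?_⟩
      rw [h.coe_exp]
      simp [h.left_inv Q.2]
  geod := h.isGeodesic_ray
  geod_eq _ hc := h.eq_ray hc
  vel P w := by
    rw [velocity_of_eq (h.exp_ray P w) (h.hasDerivAt_ray (Φ P) w) zero_mem_I]
    simp
  inj P w v hwv := by
    have := congrArg (fderiv ℝ Φ (Ψ (Φ P))) hwv
    simp only [h.fderiv_fderiv (h.mem P.2) w.2, h.fderiv_fderiv (h.mem P.2) v.2] at this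
    exact Subtype.ext this
  parallel w v := ⟨_, h.isParallel_ray 1 w v, by simp⟩
  parallel_eq w v V hV h0 := by
    have hc := (h.isParallel_iff
      (differentiableOn_extCurve_of_eq (h.exp_ray 1 w) (h.hasDerivAt_ray _ w)) hV.2.1 hV.1).mp hV 1
      one_mem_I
    rw [extCurve_zero, h0] at hc
    have h01 : Ψ (Φ (1 : SPD n)) = (h.exp 1 (((0 : I) : ℝ) • w) : Mat n) := by
      rw [h.exp_ray]; simp
    rw [← h01, h.fderiv_fderiv (h.mem (1 : SPD n).2) v.2] at hc
    have h1 := h.fderiv_fderiv' (extCurve_posDef (fun t : I => h.exp 1 ((t : ℝ) • w)) 1) (hV.1 1 one_mem_I)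
    rw [hc, extCurve_one] at h1
    simpa using h1.symm
  smul s w := by simp
  metric_smul := hsmul
  metric_pos w hw := by
    have : Φ (1 : SPD n) = 0 := h.one
    rw [this, h.metric_one]
    exact frob_self_pos fun h0 => hw (Subtype.ext h0)
  -- As `Φ 1 = 0`, gyroaddition is addition of coordinates, and cancellation is that of `W`.
  cancel w v u huv := by
    have h1 : Φ (1 : SPD n) = 0 := h.one
    have h2 := congrArg (fun Q : SPD n => Φ Q) huv
    simp only [h.chart_exp, h1, zero_add] at h2
    refine Subtype.ext ?_
    rw [h.coe_exp, h.chart_exp, h.coe_exp, h1, ← h2]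
    simp

end FlatChart

/-! ### Charts from the inverse function theorem -/

/-- In finite dimension an injective derivative is invertible, so the inverse function theorem
applies. -/
theorem exists_localInverse {E : Type} [NormedAddCommGroup E] [NormedSpace ℝ E]
    [FiniteDimensional ℝ E] {F : E → E} (hF : ContDiff ℝ 2 F) (x : E)
    (hinj : ∀ v, fderiv ℝ F x v = 0 → v = 0) :
    ∃ k : E → E, ContDiffAt ℝ 2 k (F x) ∧ k (F x) = x ∧ (∀ᶠ y in 𝓝 (F x), F (k y) = y) ∧
      ∀ᶠ y in 𝓝 x, k (F y) = y := by
  have : CompleteSpace E := FiniteDimensional.complete ℝ E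
  have hinj' : Function.Injective (fderiv ℝ F x : E →ₗ[ℝ] E) :=
    (injective_iff_map_eq_zero _).mpr hinj
  let L : E ≃L[ℝ] E := (LinearEquiv.ofInjectiveEndo _ hinj').toContinuousLinearEquiv
  have hL : HasFDerivAt F (L : E →L[ℝ] E) x := by
    have h1 : (L : E →L[ℝ] E) = fderiv ℝ F x := by ext v; rfl
    rw [h1]
    exact (hF.differentiable two_ne_zero x).hasFDerivAt
  have hs : HasStrictFDerivAt F (L : E →L[ℝ] E) x :=
    hF.contDiffAt.hasStrictFDerivAt' hL two_ne_zero
  exact ⟨hs.localInverse F L x, hF.contDiffAt.to_localInverse hL two_ne_zero,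
    hs.localInverse_apply_image, hs.eventually_right_inverse, hs.eventually_left_inverse⟩

/-- The symmetric part of a matrix. -/
def symPart (A : Mat n) : Mat n := (1 / 2 : ℝ) • (A + A.transpose)

theorem symPart_of_isSymm {A : Mat n} (h : A.IsSymm) : symPart A = A := by
  rw [symPart, h.eq, ← two_smul ℝ A, smul_smul]; norm_num

theorem symPart_isSymm (A : Mat n) : (symPart A).IsSymm := by
  rw [Matrix.IsSymm, symPart, Matrix.transpose_smul, Matrix.transpose_add,
    Matrix.transpose_transpose, add_comm]

theorem contDiff_symPart {k : WithTop ℕ∞} : ContDiff ℝ k (symPart : Mat n → Mat n) := by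
  let L : Mat n →ₗ[ℝ] Mat n := (1 / 2 : ℝ) • (LinearMap.id +
    (Matrix.transposeLinearEquiv (Fin n) (Fin n) ℝ ℝ).toLinearMap)
  exact L.toContinuousLinearMap.contDiff

theorem tendsto_symPart {P : Mat n} (hP : P.IsSymm) :
    Filter.Tendsto (symPart : Mat n → Mat n) (𝓝 P) (𝓝 P) := by
  have := (contDiff_symPart (n := n) (k := 0)).continuous.tendsto P
  rwa [symPart_of_isSymm hP] at this

/-- `matLog` and `chol` take default values off the symmetric matrices, so they need not be
differentiable on the full matrix space. Precomposing with `symPart` repairs this without changing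
derivatives in symmetric directions. -/
theorem dirDeriv_eq_fderiv_symPart {Φ : Mat n → Mat n} {P u : Mat n} (hP : P.IsSymm)
    (hu : u.IsSymm) (hd : DifferentiableAt ℝ (fun A => Φ (symPart A)) P) :
    dirDeriv Φ P u = fderiv ℝ (fun A => Φ (symPart A)) P u := by
  rw [← dirDeriv_eq_fderiv hd, dirDeriv, dirDeriv]
  congr 1
  funext s
  rw [symPart_of_isSymm (hP.add (hu.smul s))]

theorem dirDeriv_smul (f : Mat n → Mat n) (P u : Mat n) (s : ℝ) :
    dirDeriv f P (s • u) = s • dirDeriv f P u := by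
  have := deriv_comp_mul_left s (fun r : ℝ => f (P + r • u)) 0
  rw [mul_zero] at this
  rw [dirDeriv, dirDeriv, ← this]
  congr 1
  funext r
  rw [smul_smul, mul_comm]

/-- The local inverse `k` of `F` lives on all matrices. By `hloc` it sends nearby symmetric `Q` into
`W`, where `hinv` identifies `k Q` with `Φ Q` and `hpos` makes `Q = F (k Q)` positive definite. -/
theorem eventually_chart_eq {W : Submodule ℝ (Mat n)} {F Φ : Mat n → Mat n}
    (hF : ContDiff ℝ 2 F) (hker : ∀ X ∈ W, ∀ H, fderiv ℝ F X H = 0 → H = 0)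
    (hloc : ∀ X ∈ W, ∀ᶠ Y in 𝓝 X, (F Y).IsSymm → Y ∈ W)
    (hpos : ∀ X ∈ W, (F X).PosDef) (hinv : ∀ X ∈ W, Φ (F X) = X)
    {X : Mat n} (hX : X ∈ W) : ∃ k : Mat n → Mat n, ContDiffAt ℝ 2 k (F X) ∧
      ∀ᶠ Q in 𝓝 (F X), Q.IsSymm → Q.PosDef ∧ Φ Q = k Q := by
  obtain ⟨k, hk, hkX, hr, -⟩ := exists_localInverse hF X (hker X hX)
  refine ⟨k, hk, ?_⟩
  have ht : Filter.Tendsto k (𝓝 (F X)) (𝓝 X) := by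
    have := hk.continuousAt.tendsto
    rwa [hkX] at this
  filter_upwards [hr, ht.eventually (hloc X hX)] with Q h1 h2 hQ
  rw [h1] at h2
  have h3 := hpos _ (h2 hQ)
  have h4 := hinv _ (h2 hQ)
  rw [h1] at h3 h4
  exact ⟨h3, h4⟩

/-- `F` extends `Ψ` from `W` to a map with injective derivative at points of `W`. The exponential is
its own extension; the Cholesky parametrization ignores the strictly upper entries and needs a
correction. -/
theorem FlatChart.of_symPart {g : Metric n} {W : Submodule ℝ (Mat n)} {F Φ Ψ : Mat n → Mat n}
    (hF : ContDiff ℝ 2 F) (hΨ : ContDiff ℝ 2 Ψ) (hFΨ : ∀ X ∈ W, F X = Ψ X)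
    (hker : ∀ X ∈ W, ∀ H, fderiv ℝ F X H = 0 → H = 0)
    (hloc : ∀ X ∈ W, ∀ᶠ Y in 𝓝 X, (F Y).IsSymm → Y ∈ W)
    (hpos : ∀ X ∈ W, (Ψ X).PosDef) (hinv : ∀ X ∈ W, Φ (Ψ X) = X)
    (hmem : ∀ P : Mat n, P.PosDef → Φ P ∈ W) (hleft : ∀ P : Mat n, P.PosDef → Ψ (Φ P) = P)
    (hone : Φ 1 = 0)
    (hmetric : ∀ P u v : Mat n, P.PosDef → u.IsSymm → v.IsSymm →
      ContDiffAt ℝ 2 (fun A => Φ (symPart A)) P → (∀ᶠ Q in 𝓝 P, Q.IsSymm → Q.PosDef) →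
      g P u v = frob (fderiv ℝ (fun A => Φ (symPart A)) P u)
        (fderiv ℝ (fun A => Φ (symPart A)) P v)) :
    FlatChart g W (fun A => Φ (symPart A)) Ψ := by
  have key : ∀ P : Mat n, P.PosDef → ∃ k : Mat n → Mat n, ContDiffAt ℝ 2 k P ∧
      ∀ᶠ Q in 𝓝 P, Q.IsSymm → Q.PosDef ∧ Φ Q = k Q := by
    intro P hP
    have h1 := eventually_chart_eq (Φ := Φ) hF hker hloc
      (fun X hX => by rw [hFΨ X hX]; exact hpos X hX)
      (fun X hX => by rw [hFΨ X hX]; exact hinv X hX) (hmem P hP)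
    rwa [hFΨ _ (hmem P hP), hleft P hP] at h1
  have hcd : ∀ P : Mat n, P.PosDef → ContDiffAt ℝ 2 (fun A => Φ (symPart A)) P := by
    intro P hP
    obtain ⟨k, hk, hev⟩ := key P hP
    have hPs := isSymm_of_posDef hP
    have hk' : ContDiffAt ℝ 2 k (symPart P) := by rwa [symPart_of_isSymm hPs]
    refine (hk'.comp P contDiff_symPart.contDiffAt).congr_of_eventuallyEq ?_
    filter_upwards [(tendsto_symPart hPs).eventually hev] with Q hQ
    exact (hQ (symPart_isSymm Q)).2
  have hnhds : ∀ P : Mat n, P.PosDef → ∀ᶠ Q in 𝓝 P, Q.IsSymm → Q.PosDef := by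
    intro P hP
    obtain ⟨k, -, hev⟩ := key P hP
    exact hev.mono fun Q hQ hs => (hQ hs).1
  have hsym : ∀ P : Mat n, P.PosDef → symPart P = P := fun P hP =>
    symPart_of_isSymm (isSymm_of_posDef hP)
  constructor
  · intro P hP; rw [hsym P hP]; exact hmem P hP
  · intro P hP; rw [hsym P hP]; exact hleft P hP
  · exact fun hX => hpos _ hX
  · intro X hX; rw [hsym _ (hpos X hX)]; exact hinv X hX
  · rw [hsym _ Matrix.PosDef.one]; exact hone
  · exact fun hP => hnhds _ hP
  · exact hΨ
  · exact fun hP => hcd _ hP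
  · exact fun hP hu hv => hmetric _ _ _ hP hu hv (hcd _ hP) (hnhds _ hP)

/-! ### The Log-Euclidean metric -/

/-- Differentiating the commutation of `X + s • H` with its exponential, whose derivative vanishes,
shows that `H` commutes with `exp X`. Hence `H` commutes with `X`, the derivative is `exp X * H`,
and `H = 0`. -/
theorem fderiv_exp_injective {X H : Mat n} (hX : X.IsSymm)
    (h : fderiv ℝ (NormedSpace.exp : Mat n → Mat n) X H = 0) : H = 0 := by
  have hd : DifferentiableAt ℝ (NormedSpace.exp : Mat n → Mat n) X :=
    (contDiff_matExp (k := 2)).differentiable two_ne_zero X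
  have h1 : HasDerivAt (fun s : ℝ => NormedSpace.exp (X + s • H)) 0 0 := by
    have := hasDerivAt_comp_line hd H
    rwa [h] at this
  have h2 := hasDerivAt_line X H 0
  have h3 := (h2.mul h1).sub (h1.mul h2)
  have h4 : ((fun s : ℝ => X + s • H) * fun s : ℝ => NormedSpace.exp (X + s • H)) -
      (fun s : ℝ => NormedSpace.exp (X + s • H)) * (fun s : ℝ => X + s • H) = fun _ => 0 := by
    funext s
    exact sub_eq_zero.mpr ((Commute.refl (X + s • H)).exp_right).eq
  rw [h4] at h3
  have h5 := (hasDerivAt_const (0 : ℝ) (0 : Mat n)).unique h3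
  simp only [zero_smul, add_zero, mul_zero, zero_mul, zero_add] at h5
  have h6 : Commute (NormedSpace.exp X) H := (sub_eq_zero.mp h5.symm).symm
  -- `X` is the logarithm of `exp X` in the functional calculus, so it inherits the commutation.
  have h7 : Commute X H := by
    have := Commute.cfc_real h6 Real.log
    rwa [show cfc Real.log (NormedSpace.exp X) = X from matLog_exp hX] at this
  have h8 : (fun s : ℝ => NormedSpace.exp (X + s • H)) =
      fun s : ℝ => NormedSpace.exp X * NormedSpace.exp (s • H) := by
    funext s
    exact Matrix.exp_add_of_commute _ _ (h7.smul_right s)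
  have h9 := (hasDerivAt_exp_smul H 0).const_mul (NormedSpace.exp X)
  rw [← h8] at h9
  have h10 := h1.unique h9
  simp only [zero_smul, NormedSpace.exp_zero, one_mul] at h10
  calc H = NormedSpace.exp (-X) * (NormedSpace.exp X * H) := by
        rw [← mul_assoc, exp_neg_mul_exp, one_mul]
    _ = 0 := by rw [← h10, mul_zero]

/-- `Y` and its transpose are both near `X` and have the same exponential, which is locally
injective. -/
theorem eventually_isSymm_of_exp {X : Mat n} (hX : X.IsSymm) :
    ∀ᶠ Y in 𝓝 X, (NormedSpace.exp Y).IsSymm → Y.IsSymm := by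
  obtain ⟨k, -, -, -, hk⟩ := exists_localInverse contDiff_matExp X
    fun H => fderiv_exp_injective hX
  have ht : Filter.Tendsto (Matrix.transpose : Mat n → Mat n) (𝓝 X) (𝓝 X) := by
    have : Filter.Tendsto (Matrix.transpose : Mat n → Mat n) (𝓝 X) (𝓝 X.transpose) :=
      (continuous_id.matrix_transpose).tendsto X
    rwa [hX.eq] at this
  filter_upwards [hk, ht.eventually hk] with Y h1 h2 hY
  rw [Matrix.exp_transpose, hY.eq, h1] at h2
  exact h2.symm

theorem leMetric_flatChart :
    FlatChart (leMetric (n := n)) (symSub n) (fun A => matLog (symPart A)) NormedSpace.exp := by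
  refine FlatChart.of_symPart (F := NormedSpace.exp) contDiff_matExp contDiff_matExp
    (fun _ _ => rfl) (fun X hX H => fderiv_exp_injective hX)
    (fun X hX => eventually_isSymm_of_exp hX) (fun X hX => exp_posDef hX)
    (fun X hX => matLog_exp hX) (fun P _ => matLog_isSymm P) (fun P hP => exp_matLog hP) ?_ ?_
  · have := matLog_exp (X := (0 : Mat n)) Matrix.isSymm_zero
    rwa [NormedSpace.exp_zero] at this
  · intro P u v hP hu hv hd _
    have hd' := hd.differentiableAt two_ne_zero
    have hPs := isSymm_of_posDef hP
    have hsymm : (fderiv ℝ (fun A => matLog (symPart A)) P v).IsSymm :=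
      mem_of_hasDerivAt (W := symSub n) (hasDerivAt_comp_line hd' v)
        (Filter.Eventually.of_forall fun s => matLog_isSymm _)
    rw [leMetric, dirDeriv_eq_fderiv_symPart hPs hu hd', dirDeriv_eq_fderiv_symPart hPs hv hd',
      frob, hsymm.eq]

theorem leMetric_smul (s : ℝ) (u : Mat n) :
    leMetric 1 (s • u) (s • u) = s ^ 2 * leMetric 1 u u := by
  simp only [leMetric, dirDeriv_smul, Matrix.smul_mul, Matrix.mul_smul, Matrix.trace_smul,
    smul_eq_mul]
  ring

/-! ### The Cholesky decomposition -/

/-- The space of lower triangular matrices. -/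
def lowSub (n : ℕ) : Submodule ℝ (Mat n) where
  carrier := {X | ∀ i j, i < j → X i j = 0}
  add_mem' := fun ha hb i j hij => by rw [Matrix.add_apply, ha i j hij, hb i j hij, add_zero]
  zero_mem' := fun _ _ _ => rfl
  smul_mem' := fun c _ hx i j hij => by rw [Matrix.smul_apply, hx i j hij, smul_zero]

theorem lowSub_mul {X Y : Mat n} (hX : X ∈ lowSub n) (hY : Y ∈ lowSub n) : X * Y ∈ lowSub n :=
  fun _ _ hij => Matrix.BlockTriangular.mul (b := OrderDual.toDual)
    (fun _ _ h => hX _ _ h) (fun _ _ h => hY _ _ h) hij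

theorem lowSub_inv {X : Mat n} (hX : X ∈ lowSub n) (hu : IsUnit X) : X⁻¹ ∈ lowSub n := by
  have := hu.invertible
  exact fun i j hij => Matrix.blockTriangular_inv_of_blockTriangular (b := OrderDual.toDual)
    (fun _ _ h => hX _ _ h) hij

theorem det_lowSub {X : Mat n} (hX : X ∈ lowSub n) : X.det = ∏ i, X i i :=
  Matrix.det_of_isLowerTriangular X (fun _ _ h => hX _ _ h)

theorem mul_diag_of_lowSub {X Y : Mat n} (hX : X ∈ lowSub n) (hY : Y ∈ lowSub n) (i : Fin n) :
    (X * Y) i i = X i i * Y i i := by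
  rw [Matrix.mul_apply]
  refine Finset.sum_eq_single i (fun j _ hj => ?_) (by simp)
  rcases lt_or_gt_of_ne hj with h | h
  · rw [hY j i h, mul_zero]
  · rw [hX i j h, zero_mul]

theorem IsCholeskyFactor.mem {L : Mat n} (h : IsCholeskyFactor L) : L ∈ lowSub n := h.1

theorem IsCholeskyFactor.isUnit {L : Mat n} (h : IsCholeskyFactor L) : IsUnit L := by
  rw [Matrix.isUnit_iff_isUnit_det, det_lowSub h.mem, isUnit_iff_ne_zero]
  exact Finset.prod_ne_zero_iff.mpr fun i _ => (h.2 i).ne'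

theorem IsCholeskyFactor.posDef {L : Mat n} (h : IsCholeskyFactor L) :
    (L * L.transpose).PosDef := by
  have := Matrix.PosDef.one.mul_mul_conjTranspose_same (B := L)
    (Matrix.vecMul_injective_of_isUnit h.isUnit)
  rwa [mul_one, Matrix.conjTranspose_eq_transpose_of_trivial] at this

/-- `M⁻¹ * L` is lower triangular and orthogonal, so its transpose, being its inverse, is lower
triangular too. It is thus diagonal with positive entries of square `1`. -/
theorem IsCholeskyFactor.unique {L M : Mat n} (hL : IsCholeskyFactor L) (hM : IsCholeskyFactor M)
    (h : L * L.transpose = M * M.transpose) : L = M := by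
  have hdM := (Matrix.isUnit_iff_isUnit_det M).mp hM.isUnit
  have hiM := lowSub_inv hM.mem hM.isUnit
  set N := M⁻¹ * L with hN
  have hNl : N ∈ lowSub n := lowSub_mul hiM hL.mem
  have hLN : M * N = L := by rw [hN, ← mul_assoc, Matrix.mul_nonsing_inv M hdM, one_mul]
  have hNN : N * N.transpose = 1 := by
    rw [hN, Matrix.transpose_mul, mul_assoc, ← mul_assoc L, h, Matrix.transpose_nonsing_inv,
      mul_assoc M, Matrix.mul_nonsing_inv _ (by rwa [Matrix.det_transpose]), mul_one,
      Matrix.nonsing_inv_mul M hdM]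
  have hNu : IsUnit N := ⟨⟨N, N.transpose, hNN, mul_eq_one_comm.mp hNN⟩, rfl⟩
  have hNt : N.transpose ∈ lowSub n := by
    rw [← Matrix.inv_eq_right_inv hNN]; exact lowSub_inv hNl hNu
  have hpos : ∀ i, 0 < N i i := by
    intro i
    have h1 := mul_diag_of_lowSub hM.mem hNl i
    rw [hLN] at h1
    exact pos_of_mul_pos_right (h1 ▸ hL.2 i) (hM.2 i).le
  have hN1 : N = 1 := by
    ext i j
    rcases lt_trichotomy i j with hij | rfl | hij
    · rw [hNl i j hij, Matrix.one_apply_ne hij.ne]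
    · have h1 := mul_diag_of_lowSub hNl hNt i
      rw [hNN, Matrix.one_apply_eq, Matrix.transpose_apply] at h1
      rw [Matrix.one_apply_eq]
      nlinarith [hpos i]
    · have := hNt j i hij
      rw [Matrix.transpose_apply] at this
      rw [this, Matrix.one_apply_ne hij.ne']
  rw [← hLN, hN1, mul_one]

theorem exists_choleskyFactor {P : Mat n} (hP : P.PosDef) :
    ∃ L : Mat n, IsCholeskyFactor L ∧ L * L.transpose = P := by
  set N : Mat n := LDL.lowerInv hP with hN
  have hNl : N ∈ lowSub n := fun i j hij => LDL.lowerInv_triangular hP hij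
  have hNu : IsUnit N := @isUnit_of_invertible _ _ N (LDL.invertibleLowerInv hP)
  have hNd := (Matrix.isUnit_iff_isUnit_det N).mp hNu
  set K := N⁻¹ with hK
  have hKl : K ∈ lowSub n := lowSub_inv hNl hNu
  have hKu : IsUnit K := Matrix.isUnit_nonsing_inv_iff.mpr hNu
  have hdiag := LDL.diag_eq_lowerInv_conj hP
  rw [Matrix.conjTranspose_eq_transpose_of_trivial, LDL.diag] at hdiag
  have hDpos : (Matrix.diagonal (LDL.diagEntries hP)).PosDef := by
    rw [hdiag, ← Matrix.conjTranspose_eq_transpose_of_trivial]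
    exact hP.mul_mul_conjTranspose_same (Matrix.vecMul_injective_of_isUnit hNu)
  set d := LDL.diagEntries hP with hd
  have hdp : ∀ i, 0 < d i := fun i => by simpa using hDpos.diag_pos (i := i)
  have hPd : K * Matrix.diagonal d * K.transpose = P := by
    rw [hdiag, hK, Matrix.transpose_nonsing_inv, ← hN, mul_assoc, mul_assoc, mul_assoc,
      Matrix.mul_nonsing_inv _ (by rwa [Matrix.det_transpose]), mul_one, ← mul_assoc,
      Matrix.nonsing_inv_mul N hNd, one_mul]
  have hKne : ∀ i, K i i ≠ 0 := by
    have h1 := (Matrix.isUnit_iff_isUnit_det K).mp hKu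
    rw [det_lowSub hKl, isUnit_iff_ne_zero, Finset.prod_ne_zero_iff] at h1
    exact fun i => h1 i (Finset.mem_univ i)
  -- The square root absorbs the diagonal of the LDL decomposition; the sign makes the diagonal of
  -- the factor positive.
  set s : Fin n → ℝ := fun i => √(d i) * (K i i / |K i i|) with hs
  refine ⟨K * Matrix.diagonal s, ⟨fun i j hij => ?_, fun i => ?_⟩, ?_⟩
  · rw [Matrix.mul_diagonal, hKl i j hij, zero_mul]
  · rw [Matrix.mul_diagonal, hs]
    have h1 := mul_self_pos.mpr (hKne i)
    have h2 := abs_pos.mpr (hKne i)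
    have h3 := Real.sqrt_pos.mpr (hdp i)
    have : K i i * (√(d i) * (K i i / |K i i|)) = √(d i) * ((K i i * K i i) / |K i i|) := by ring
    rw [this]
    positivity
  · rw [Matrix.transpose_mul, Matrix.diagonal_transpose, mul_assoc, ← mul_assoc (Matrix.diagonal s),
      Matrix.diagonal_mul_diagonal, ← mul_assoc]
    suffices hss : (fun i => s i * s i) = d by rw [hss]; exact hPd
    funext i
    have h2 := abs_pos.mpr (hKne i)
    have h3 : K i i / |K i i| * (K i i / |K i i|) = 1 := by
      rw [div_mul_div_comm, abs_mul_abs_self, div_self (mul_self_ne_zero.mpr (hKne i))]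
    calc s i * s i = (√(d i) * √(d i)) * (K i i / |K i i| * (K i i / |K i i|)) := by
          rw [hs]; ring
      _ = d i := by rw [h3, mul_one, Real.mul_self_sqrt (hdp i).le]

theorem chol_spec {P : Mat n} (hP : P.PosDef) :
    IsCholeskyFactor (chol P) ∧ chol P * (chol P).transpose = P :=
  Classical.epsilon_spec (p := fun L : Mat n => IsCholeskyFactor L ∧ L * L.transpose = P)
    (exists_choleskyFactor hP)

theorem chol_eq {L : Mat n} (hL : IsCholeskyFactor L) : chol (L * L.transpose) = L :=
  (chol_spec hL.posDef).1.unique hL (chol_spec hL.posDef).2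

/-- Infinitesimal uniqueness of the Cholesky factor: `L⁻¹ * K` is lower triangular and
skew-symmetric, hence zero. -/
theorem eq_zero_of_mul_transpose_add {L K : Mat n} (hL : IsCholeskyFactor L) (hK : K ∈ lowSub n)
    (h : K * L.transpose + L * K.transpose = 0) : K = 0 := by
  have hd := (Matrix.isUnit_iff_isUnit_det L).mp hL.isUnit
  have hdt : IsUnit L.transpose.det := by rwa [Matrix.det_transpose]
  have hA : L⁻¹ * K ∈ lowSub n := lowSub_mul (lowSub_inv hL.mem hL.isUnit) hK
  set A := L⁻¹ * K with hAdef
  have hKA : K = L * A := by rw [hAdef, ← mul_assoc, Matrix.mul_nonsing_inv L hd, one_mul]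
  have h1 : A + A.transpose = 0 := by
    have h2 : K * L.transpose + L * K.transpose = L * (A + A.transpose) * L.transpose := by
      rw [hKA, Matrix.transpose_mul, mul_add, add_mul]
      simp only [mul_assoc]
    rw [h2] at h
    calc A + A.transpose = L⁻¹ * (L * (A + A.transpose) * L.transpose) * L.transpose⁻¹ := by
          rw [mul_assoc L, ← mul_assoc L⁻¹, Matrix.nonsing_inv_mul L hd, one_mul, mul_assoc,
            Matrix.mul_nonsing_inv _ hdt, mul_one]
      _ = 0 := by rw [h, mul_zero, zero_mul]
  have h2 : ∀ i j, A i j + A j i = 0 := fun i j => by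
    have := congrFun (congrFun h1 i) j
    simpa using this
  have hA0 : A = 0 := by
    ext i j
    rw [Matrix.zero_apply]
    rcases lt_trichotomy i j with hij | rfl | hij
    · exact hA i j hij
    · linarith [h2 i i]
    · linarith [h2 i j, hA j i hij]
  rw [hKA, hA0, mul_zero]

/-! ### Entrywise calculus -/

theorem hasDerivAt_matrix {f : ℝ → Mat n} {f' : Mat n} {t : ℝ}
    (h : ∀ i j, HasDerivAt (fun s => f s i j) (f' i j) t) : HasDerivAt f f' t := by
  have h1 : HasDerivAt (fun s => ∑ i, ∑ j, f s i j • (Matrix.single i j 1 : Mat n))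
      (∑ i, ∑ j, f' i j • (Matrix.single i j 1 : Mat n)) t :=
    HasDerivAt.fun_sum fun i _ => HasDerivAt.fun_sum fun j _ => (h i j).smul_const _
  have h2 : ∀ X : Mat n, ∑ i, ∑ j, X i j • (Matrix.single i j 1 : Mat n) = X := fun X => by
    conv_rhs => rw [Matrix.matrix_eq_sum_single X]
    simp
  simpa only [h2] using h1

theorem contDiff_matrix {k : WithTop ℕ∞} {f : Mat n → Mat n}
    (h : ∀ i j, ContDiff ℝ k (fun X => f X i j)) : ContDiff ℝ k f := by
  have h1 : ContDiff ℝ k (fun X => ∑ i, ∑ j, f X i j • (Matrix.single i j 1 : Mat n)) :=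
    ContDiff.sum fun i _ => ContDiff.sum fun j _ => (h i j).smul contDiff_const
  have h2 : ∀ X : Mat n, ∑ i, ∑ j, X i j • (Matrix.single i j 1 : Mat n) = X := fun X => by
    conv_rhs => rw [Matrix.matrix_eq_sum_single X]
    simp
  simpa only [h2] using h1

theorem contDiff_entry {k : WithTop ℕ∞} (i j : Fin n) : ContDiff ℝ k (fun X : Mat n => X i j) :=
  (Matrix.entryLinearMap ℝ ℝ i j).toContinuousLinearMap.contDiff

theorem hasDerivAt_entry {f : ℝ → Mat n} {f' : Mat n} {t : ℝ} (h : HasDerivAt f f' t)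
    (i j : Fin n) : HasDerivAt (fun s => f s i j) (f' i j) t :=
  ((Matrix.entryLinearMap ℝ ℝ i j).toContinuousLinearMap).hasFDerivAt.comp_hasDerivAt t h

theorem contDiff_transpose {k : WithTop ℕ∞} :
    ContDiff ℝ k (Matrix.transpose : Mat n → Mat n) :=
  ((Matrix.transposeLinearEquiv (Fin n) (Fin n) ℝ
    ℝ).toLinearMap.toContinuousLinearMap).contDiff

/-! ### The Log-Cholesky chart -/

/-- The Cholesky factor whose strictly lower part is that of `X` and whose diagonal is the
exponential of that of `X`. -/
def cholExp (X : Mat n) : Mat n :=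
  Matrix.of fun i j => if j < i then X i j else if i = j then Real.exp (X i i) else 0

/-- The derivative of `cholExp` at `X` in the direction `H`. -/
def cholExpDeriv (X H : Mat n) : Mat n :=
  Matrix.of fun i j => if j < i then H i j else if i = j then Real.exp (X i i) * H i i else 0

/-- The logarithmic coordinates of the Cholesky factor. -/
def cholLog (P : Mat n) : Mat n :=
  Matrix.of fun i j => if j < i then chol P i j else if i = j then Real.log (chol P i i) else 0

/-- The strictly upper triangular part. -/
def upPart (X : Mat n) : Mat n := Matrix.of fun i j => if i < j then X i j else 0

theorem cholExp_isCholeskyFactor (X : Mat n) : IsCholeskyFactor (cholExp X) := by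
  refine ⟨fun i j hij => ?_, fun i => ?_⟩
  · simp [cholExp, hij.not_gt, hij.ne]
  · simp [cholExp, Real.exp_pos]

theorem cholExpDeriv_mem (X H : Mat n) : cholExpDeriv X H ∈ lowSub n := fun i j hij => by
  simp [cholExpDeriv, hij.not_gt, hij.ne]

theorem cholLog_mem (P : Mat n) : cholLog P ∈ lowSub n := fun i j hij => by
  simp [cholLog, hij.not_gt, hij.ne]

theorem cholLog_eq {X : Mat n} (hX : X ∈ lowSub n) :
    cholLog (cholExp X * (cholExp X).transpose) = X := by
  ext i j
  rw [cholLog, chol_eq (cholExp_isCholeskyFactor X)]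
  rcases lt_trichotomy i j with hij | rfl | hij
  · simp [hij.not_gt, hij.ne, hX i j hij]
  · simp [cholExp]
  · simp [cholExp, hij]

theorem cholExp_cholLog {P : Mat n} (hP : P.PosDef) : cholExp (cholLog P) = chol P := by
  have hL := (chol_spec hP).1
  ext i j
  rcases lt_trichotomy i j with hij | rfl | hij
  · simp [cholExp, hij.not_gt, hij.ne, hL.1 i j hij]
  · simp [cholExp, cholLog, Real.exp_log (hL.2 i)]
  · simp [cholExp, cholLog, hij]

theorem contDiff_cholExp {k : WithTop ℕ∞} : ContDiff ℝ k (cholExp : Mat n → Mat n) := by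
  refine contDiff_matrix fun i j => ?_
  simp only [cholExp, Matrix.of_apply]
  split_ifs
  · exact contDiff_entry i j
  · exact (contDiff_entry i i).exp
  · exact contDiff_const

theorem hasDerivAt_cholExp {f : ℝ → Mat n} {f' : Mat n} {t : ℝ} (h : HasDerivAt f f' t) :
    HasDerivAt (fun s => cholExp (f s)) (cholExpDeriv (f t) f') t := by
  refine hasDerivAt_matrix fun i j => ?_
  simp only [cholExp, cholExpDeriv, Matrix.of_apply]
  split_ifs
  · exact hasDerivAt_entry h i j
  · exact (hasDerivAt_entry h i i).exp
  · exact hasDerivAt_const _ _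

theorem contDiff_upPart {k : WithTop ℕ∞} : ContDiff ℝ k (upPart : Mat n → Mat n) := by
  refine contDiff_matrix fun i j => ?_
  simp only [upPart, Matrix.of_apply]
  split_ifs
  · exact contDiff_entry i j
  · exact contDiff_const

theorem hasDerivAt_upPart {f : ℝ → Mat n} {f' : Mat n} {t : ℝ} (h : HasDerivAt f f' t) :
    HasDerivAt (fun s => upPart (f s)) (upPart f') t := by
  refine hasDerivAt_matrix fun i j => ?_
  simp only [upPart, Matrix.of_apply]
  split_ifs
  · exact hasDerivAt_entry h i j
  · exact hasDerivAt_const _ _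

/-- The inverse of the Log-Cholesky chart. -/
def cholChartInv (X : Mat n) : Mat n := cholExp X * (cholExp X).transpose

/-- An extension of `cholChartInv` to a local diffeomorphism of the space of all matrices. -/
def cholChartExt (X : Mat n) : Mat n := cholChartInv X + (upPart X - (upPart X).transpose)

/-- The added term is skew-symmetric, so symmetry of the sum kills it and with it the strictly upper
part of `X`. -/
theorem mem_lowSub_of_add {S X : Mat n} (hS : S.IsSymm)
    (h : (S + (upPart X - (upPart X).transpose)).IsSymm) : X ∈ lowSub n := by
  intro i j hij
  have h1 := congrFun (congrFun h i) j
  have h2 := congrFun (congrFun hS i) j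
  simp only [Matrix.transpose_apply, Matrix.add_apply, Matrix.sub_apply, upPart, Matrix.of_apply,
    hij, hij.not_gt, if_true, if_false] at h1 h2
  linarith

theorem upPart_of_mem {X : Mat n} (hX : X ∈ lowSub n) : upPart X = 0 := by
  ext i j
  simp only [upPart, Matrix.of_apply, Matrix.zero_apply]
  split_ifs with h
  · exact hX i j h
  · rfl

theorem mul_transpose_isSymm (L : Mat n) : (L * L.transpose).IsSymm := by
  rw [Matrix.IsSymm, Matrix.transpose_mul, Matrix.transpose_transpose]

theorem contDiff_cholChartInv {k : WithTop ℕ∞} : ContDiff ℝ k (cholChartInv : Mat n → Mat n) :=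
  contDiff_cholExp.mul (contDiff_transpose.comp contDiff_cholExp)

theorem contDiff_cholChartExt {k : WithTop ℕ∞} : ContDiff ℝ k (cholChartExt : Mat n → Mat n) :=
  contDiff_cholChartInv.add (contDiff_upPart.sub (contDiff_transpose.comp contDiff_upPart))

/-- The derivative is a symmetric term plus a skew one, and both vanish. The skew term makes `H`
lower triangular; the symmetric one gives `cholExpDeriv X H = 0`, hence `H = 0` as exponentials are
nonzero. -/
theorem fderiv_cholChartExt_injective {X H : Mat n}
    (h : fderiv ℝ (cholChartExt : Mat n → Mat n) X H = 0) : H = 0 := by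
  have h1 := hasDerivAt_comp_line
    ((contDiff_cholChartExt (n := n) (k := 2)).differentiable two_ne_zero X) H
  have h2 := hasDerivAt_line X H 0
  have h3 := hasDerivAt_cholExp h2
  have h4 := hasDerivAt_upPart h2
  have h5 := h1.unique ((h3.mul (hasDerivAt_transpose h3)).add (h4.sub (hasDerivAt_transpose h4)))
  rw [h] at h5
  simp only [zero_smul, add_zero] at h5
  set K := cholExpDeriv X H with hK
  set L := cholExp X with hL
  have hS : (K * L.transpose + L * K.transpose).IsSymm := by
    rw [Matrix.IsSymm, Matrix.transpose_add, Matrix.transpose_mul, Matrix.transpose_mul,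
      Matrix.transpose_transpose, Matrix.transpose_transpose, add_comm]
  have hH : H ∈ lowSub n := mem_lowSub_of_add hS (by rw [← h5]; exact Matrix.isSymm_zero)
  rw [upPart_of_mem hH, Matrix.transpose_zero, sub_zero, add_zero] at h5
  have hK0 := eq_zero_of_mul_transpose_add (cholExp_isCholeskyFactor X)
    (cholExpDeriv_mem X H) h5.symm
  ext i j
  have h6 := congrFun (congrFun hK0 i) j
  rw [Matrix.zero_apply] at h6 ⊢
  rcases lt_trichotomy i j with hij | rfl | hij
  · exact hH i j hij
  · simpa [cholExpDeriv, Real.exp_ne_zero] using h6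
  · simpa [cholExpDeriv, hij] using h6

/-- The weight `L_jj⁻²` cancels the two factors `exp (X j j)` from differentiating the diagonal. -/
theorem choleskySpaceMetric_eq {X H K : Mat n} (hH : H ∈ lowSub n) :
    choleskySpaceMetric (cholExp X) (cholExpDeriv X H) (cholExpDeriv X K) = frob H K := by
  rw [choleskySpaceMetric, frob_eq_sum, ← Finset.sum_add_distrib]
  refine Finset.sum_congr rfl fun i _ => ?_
  have h1 : cholExpDeriv X H i i * cholExpDeriv X K i i * (cholExp X i i ^ 2)⁻¹ =
      ∑ j, if i = j then H i j * K i j else 0 := by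
    rw [Finset.sum_ite_eq]
    have := Real.exp_ne_zero (X i i)
    simp only [cholExpDeriv, cholExp, Matrix.of_apply, lt_irrefl, if_false, if_true,
      Finset.mem_univ]
    field_simp
  rw [h1, ← Finset.sum_add_distrib]
  refine Finset.sum_congr rfl fun j _ => ?_
  rcases lt_trichotomy i j with hij | rfl | hij
  · simp [hij.not_gt, hij.ne, hH i j hij]
  · simp
  · simp [cholExpDeriv, hij, hij.ne']

theorem chol_one : chol (1 : Mat n) = 1 := by
  have h : IsCholeskyFactor (1 : Mat n) :=
    ⟨fun i j hij => Matrix.one_apply_ne hij.ne, fun i => by simp⟩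
  have := chol_eq h
  rwa [Matrix.transpose_one, mul_one] at this

theorem lcMetric_flatChart :
    FlatChart (lcMetric (n := n)) (lowSub n) (fun A => cholLog (symPart A)) cholChartInv := by
  refine FlatChart.of_symPart (F := cholChartExt) contDiff_cholChartExt contDiff_cholChartInv
    (fun X hX => ?_) (fun X _ H => fderiv_cholChartExt_injective)
    (fun X _ => Filter.Eventually.of_forall fun Y hY =>
      mem_lowSub_of_add (mul_transpose_isSymm _) hY)
    (fun X _ => (cholExp_isCholeskyFactor X).posDef) (fun X hX => cholLog_eq hX)
    (fun P _ => cholLog_mem P) (fun P hP => ?_) ?_ ?_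
  · simp [cholChartExt, upPart_of_mem hX]
  · rw [cholChartInv, cholExp_cholLog hP]; exact (chol_spec hP).2
  · ext i j
    rw [cholLog, chol_one]
    rcases lt_trichotomy i j with hij | rfl | hij
    · simp [hij.not_gt]
    · simp
    · simp [hij, hij.ne']
  · intro P u v hP hu hv hd hn
    have hPs := isSymm_of_posDef hP
    have hd' := hd.differentiableAt two_ne_zero
    -- Near `P` on symmetric matrices `chol = cholExp ∘ cholLog`; the chain rule gives the formula.
    have key : ∀ w : Mat n, w.IsSymm → dirDeriv chol P w =
        cholExpDeriv (cholLog P) (fderiv ℝ (fun A => cholLog (symPart A)) P w) := by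
      intro w hw
      have h1 := hasDerivAt_cholExp (hasDerivAt_comp_line hd' w)
      rw [zero_smul, add_zero, symPart_of_isSymm hPs] at h1
      refine (h1.congr_of_eventuallyEq ?_).deriv
      filter_upwards [(tendsto_line P w).eventually hn] with s hs
      have hss := hPs.add (hw.smul s)
      rw [symPart_of_isSymm hss, cholExp_cholLog (hs hss)]
    rw [lcMetric, key u hu, key v hv, ← cholExp_cholLog hP]
    exact choleskySpaceMetric_eq (mem_of_hasDerivAt (hasDerivAt_comp_line hd' u)
      (Filter.Eventually.of_forall fun s => cholLog_mem _))

theorem lcMetric_smul (s : ℝ) (u : Mat n) :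
    lcMetric 1 (s • u) (s • u) = s ^ 2 * lcMetric 1 u u := by
  simp only [lcMetric, choleskySpaceMetric, dirDeriv_smul, Matrix.smul_apply, smul_eq_mul, mul_add,
    Finset.mul_sum]
  congr 1
  · refine Finset.sum_congr rfl fun i _ => Finset.sum_congr rfl fun j _ => ?_
    split_ifs
    · ring
    · ring
  · refine Finset.sum_congr rfl fun i _ => ?_
    ring

/-! ### The affine-invariant metrics -/

theorem aiMetric_add_left (β : ℝ) (P u v w : Mat n) :
    aiMetric β P (u + v) w = aiMetric β P u w + aiMetric β P v w := by
  simp only [aiMetric, mul_add, add_mul, Matrix.trace_add]; ring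

theorem aiMetric_smul (β : ℝ) (P : Mat n) (s : ℝ) (u : Mat n) :
    aiMetric β P (s • u) (s • u) = s ^ 2 * aiMetric β P u u := by
  simp only [aiMetric, Matrix.mul_smul, Matrix.smul_mul, Matrix.trace_smul, smul_eq_mul]; ring

theorem dirDeriv_aiMetric (β : ℝ) {P : Mat n} (hP : P.PosDef) (d u v : Mat n) :
    dirDeriv (fun Q => aiMetric β Q u v) P d =
      -(P⁻¹ * d * P⁻¹ * u * P⁻¹ * v).trace - (P⁻¹ * u * P⁻¹ * d * P⁻¹ * v).trace
        - β * ((P⁻¹ * d * P⁻¹ * u).trace * (P⁻¹ * v).trace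
          + (P⁻¹ * u).trace * (P⁻¹ * d * P⁻¹ * v).trace) := by
  have hl := hasDerivAt_line P d 0
  have hu : IsUnit (P + (0 : ℝ) • d).det := by
    rw [zero_smul, add_zero]; exact isUnit_det_of_posDef hP
  have hi := hasDerivAt_inv hl hu
  have h1 := (hi.mul_const u)
  have h2 := (hi.mul_const v)
  have h3 := (hasDerivAt_trace (h1.mul h2)).add
    (((hasDerivAt_trace h1).const_mul β).mul (hasDerivAt_trace h2))
  have h4 : dirDeriv (fun Q => aiMetric β Q u v) P d = _ :=
    HasDerivAt.deriv (f := fun s : ℝ => aiMetric β (P + s • d) u v)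
      (h3.congr_of_eventuallyEq (Filter.Eventually.of_forall fun s => by
        simp [aiMetric, mul_assoc]))
  rw [h4]
  simp only [zero_smul, add_zero, neg_mul, mul_neg, Matrix.trace_add, Matrix.trace_neg, ← mul_assoc]
  ring

/-- Cyclicity of the trace collects the terms. The vector on the right does not involve `β`: all
these metrics share one Levi-Civita connection. -/
theorem christoffel_aiMetric (β : ℝ) {P : Mat n} (hP : P.PosDef) (u v w : Mat n) :
    christoffel (aiMetric β) P u v w =
      aiMetric β P (-((1 / 2 : ℝ) • (u * P⁻¹ * v + v * P⁻¹ * u))) w := by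
  rw [christoffel, dirDeriv_aiMetric β hP, dirDeriv_aiMetric β hP, dirDeriv_aiMetric β hP]
  have hc : ∀ a b c : Mat n, (P⁻¹ * a * P⁻¹ * b * P⁻¹ * c).trace =
      (P⁻¹ * b * P⁻¹ * c * P⁻¹ * a).trace := by
    intro a b c
    have := Matrix.trace_mul_comm (P⁻¹ * a) (P⁻¹ * b * (P⁻¹ * c))
    simpa only [← mul_assoc] using this
  have hc2 : ∀ a b : Mat n, (P⁻¹ * a * P⁻¹ * b).trace = (P⁻¹ * b * P⁻¹ * a).trace := by
    intro a b
    have := Matrix.trace_mul_comm (P⁻¹ * a) (P⁻¹ * b)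
    simpa only [← mul_assoc] using this
  rw [hc w u v, hc u w v, hc w v u, hc2 w u, hc2 v u, hc2 w v]
  simp only [aiMetric, mul_add, add_mul, mul_neg, neg_mul, Matrix.mul_smul, Matrix.smul_mul,
    Matrix.trace_add, Matrix.trace_neg, Matrix.trace_smul, smul_eq_mul, ← mul_assoc]
  rw [hc2 v u]
  ring

/-- Testing with `w = P` gives `(1 + nβ) tr(P⁻¹Z) = 0`, which removes the `β` term; testing with `w
= PZP` then gives `tr(Z²) = 0`. -/
theorem aiMetric_nondegenerate {β : ℝ} (hβ : 0 < 1 + n * β) {P Z : Mat n} (hP : P.PosDef)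
    (hZ : Z.IsSymm) (h : ∀ w : Mat n, w.IsSymm → aiMetric β P Z w = 0) : Z = 0 := by
  have hd := isUnit_det_of_posDef hP
  have hPs := isSymm_of_posDef hP
  have hPP : P⁻¹ * P = 1 := Matrix.nonsing_inv_mul P hd
  have h1 := h P hPs
  rw [aiMetric, mul_assoc, hPP, mul_one, Matrix.trace_one, Fintype.card_fin] at h1
  have h2 : (P⁻¹ * Z).trace = 0 := by
    have : (1 + n * β) * (P⁻¹ * Z).trace = 0 := by linarith
    exact (mul_eq_zero.mp this).resolve_left hβ.ne'
  have h3 := h (P * Z * P) (by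
    rw [Matrix.IsSymm, Matrix.transpose_mul, Matrix.transpose_mul, hZ.eq, hPs.eq, mul_assoc])
  rw [aiMetric, h2, mul_zero, zero_mul, add_zero] at h3
  have h4 : (P⁻¹ * Z * P⁻¹ * (P * Z * P)).trace = frob Z Z := by
    have : P⁻¹ * Z * P⁻¹ * (P * Z * P) = P⁻¹ * (Z * Z * P) := by
      calc P⁻¹ * Z * P⁻¹ * (P * Z * P) = P⁻¹ * Z * (P⁻¹ * P) * Z * P := by simp only [mul_assoc]
        _ = _ := by rw [hPP, mul_one]; simp only [mul_assoc]
    rw [this, Matrix.trace_mul_comm, mul_assoc, Matrix.mul_nonsing_inv P hd, mul_one, frob, hZ.eq]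
  rw [h4] at h3
  exact frob_self_eq_zero h3

theorem sq_trace_le (u : Mat n) : u.trace ^ 2 ≤ n * frob u u := by
  have h1 := sq_sum_le_card_mul_sum_sq (s := Finset.univ) (f := fun i => u i i)
  rw [Finset.card_univ, Fintype.card_fin] at h1
  refine h1.trans (mul_le_mul_of_nonneg_left ?_ n.cast_nonneg)
  rw [frob_eq_sum]
  refine Finset.sum_le_sum fun i _ => ?_
  rw [sq]
  exact Finset.single_le_sum (f := fun j => u i j * u i j) (fun j _ => mul_self_nonneg _)
    (Finset.mem_univ i)

theorem aiMetric_one_pos {β : ℝ} (hβ : 0 < 1 + n * β) {u : Mat n} (hu : u.IsSymm) (h : u ≠ 0) :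
    0 < aiMetric β 1 u u := by
  have h1 : aiMetric β 1 u u = frob u u + β * u.trace ^ 2 := by
    rw [aiMetric, frob, hu.eq]; simp; ring
  have h2 := frob_self_pos h
  have h3 := sq_trace_le u
  rw [h1]
  rcases le_or_gt 0 β with hb | hb
  · positivity
  -- For `β < 0`, `(tr u)² ≤ n |u|²` bounds the form below by `(1 + nβ) |u|²`.
  · nlinarith [mul_pos hβ h2]

/-- Nondegeneracy removes the test vector and leaves a differential equation without `β`. -/
theorem isParallel_ai_iff {β : ℝ} (hβ : 0 < 1 + n * β) {c : I → SPD n} {V : ℝ → Mat n}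
    (hc : DifferentiableOn ℝ (extCurve c) (Icc 0 1)) (hV : DifferentiableOn ℝ V (Icc 0 1))
    (hs : ∀ t ∈ Icc (0 : ℝ) 1, (V t).IsSymm) :
    IsParallel (aiMetric β) c V ↔ ∀ t ∈ Icc (0 : ℝ) 1, derivWithin V (Icc 0 1) t =
      (1 / 2 : ℝ) • (velocity c t * (extCurve c t)⁻¹ * V t
        + V t * (extCurve c t)⁻¹ * velocity c t) := by
  have hs' : ∀ t ∈ Icc (0 : ℝ) 1, (derivWithin V (Icc 0 1) t).IsSymm := fun t ht =>
    mem_of_hasDerivWithinAt (W := symSub n) (hV t ht).hasDerivWithinAt (uniqueDiff_I ht)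
      (hs t ht) (eventually_mem_nhdsWithin.mono hs)
  have hinv : ∀ t, ((extCurve c t)⁻¹).IsSymm := fun t => by
    rw [Matrix.IsSymm, Matrix.transpose_nonsing_inv, (isSymm_of_posDef (extCurve_posDef c t)).eq]
  constructor
  · rintro ⟨-, -, hp⟩ t ht
    rw [← sub_eq_zero, sub_eq_add_neg]
    refine aiMetric_nondegenerate hβ (extCurve_posDef c t) ?_ fun w hw => ?_
    · have hvs := velocity_isSymm hc ht
      refine (hs' t ht).add (Matrix.IsSymm.neg (Matrix.IsSymm.smul ?_ _))
      rw [Matrix.IsSymm, Matrix.transpose_add, Matrix.transpose_mul, Matrix.transpose_mul,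
        Matrix.transpose_mul, Matrix.transpose_mul, (hs t ht).eq, (hinv t).eq, hvs.eq, add_comm,
        mul_assoc, mul_assoc]
    · rw [aiMetric_add_left, ← christoffel_aiMetric β (extCurve_posDef c t)]
      exact hp t ht w hw
  · intro hp
    refine ⟨hs, hV, fun t ht w hw => ?_⟩
    rw [christoffel_aiMetric β (extCurve_posDef c t), ← aiMetric_add_left, hp t ht, add_neg_cancel]
    simp [aiMetric]

/-! ### Square roots and affine-invariant geodesics -/

/-- The positive definite square root. -/
def sqrtMat (P : SPD n) : Mat n := matPow (P : Mat n) (1 / 2)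

/-- The inverse of the positive definite square root. -/
def invSqrtMat (P : SPD n) : Mat n := matPow (P : Mat n) (-(1 / 2))

theorem matPow_eq (P : SPD n) (s : ℝ) :
    matPow (P : Mat n) s = NormedSpace.exp (s • matLog (P : Mat n)) := by
  conv_lhs => rw [← exp_matLog P.2]
  exact matPow_exp (matLog_isSymm _) s

theorem invSqrtMat_isSymm (P : SPD n) : (invSqrtMat P).IsSymm := by
  rw [invSqrtMat, matPow_eq]; exact exp_isSymm ((matLog_isSymm _).smul _)

theorem sqrtMat_mul_self (P : SPD n) : sqrtMat P * sqrtMat P = P := by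
  rw [sqrtMat, matPow_eq, exp_half_mul_half, exp_matLog P.2]

theorem sqrtMat_mul_inv (P : SPD n) : sqrtMat P * invSqrtMat P = 1 := by
  rw [sqrtMat, invSqrtMat, matPow_eq, matPow_eq, neg_smul, exp_mul_exp_neg]

theorem invSqrtMat_mul (P : SPD n) : invSqrtMat P * sqrtMat P = 1 :=
  mul_eq_one_comm.mp (sqrtMat_mul_inv P)

theorem isUnit_invSqrtMat (P : SPD n) : IsUnit (invSqrtMat P) :=
  ⟨⟨_, _, invSqrtMat_mul P, sqrtMat_mul_inv P⟩, rfl⟩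

/-- The exponential map of the affine-invariant metrics. -/
def aiExp (P : SPD n) (w : symSub n) : SPD n :=
  spdCongr P (1 / 2) ⟨NormedSpace.exp (w : Mat n), exp_posDef w.2⟩

theorem coe_aiExp (P : SPD n) (w : symSub n) :
    (aiExp P w : Mat n) = sqrtMat P * NormedSpace.exp (w : Mat n) * sqrtMat P := rfl

theorem sandwich_isSymm {R X : Mat n} (hR : R.IsSymm) (hX : X.IsSymm) : (R * X * R).IsSymm := by
  rw [Matrix.IsSymm, Matrix.transpose_mul, Matrix.transpose_mul, hR.eq, hX.eq, mul_assoc]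

theorem sandwich_cancel {R S X : Mat n} (h : R * S = 1) : S * (R * X * R) * S = X := by
  have h' : S * R = 1 := mul_eq_one_comm.mp h
  rw [mul_assoc R, ← mul_assoc S, h', one_mul, mul_assoc, h, mul_one]

theorem aiExp_ray (P : SPD n) (w : symSub n) (t : I) :
    (aiExp P ((t : ℝ) • w) : Mat n) =
      sqrtMat P * NormedSpace.exp ((t : ℝ) • (w : Mat n)) * sqrtMat P := rfl

theorem hasDerivAt_aiRay (P : SPD n) (w : symSub n) (t : ℝ) :
    HasDerivAt (fun s : ℝ => sqrtMat P * NormedSpace.exp (s • (w : Mat n)) * sqrtMat P)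
      (sqrtMat P * (NormedSpace.exp (t • (w : Mat n)) * w) * sqrtMat P) t :=
  ((hasDerivAt_exp_smul (w : Mat n) t).const_mul (sqrtMat P)).mul_const (sqrtMat P)

theorem hasDerivAt_aiRay_velocity (P : SPD n) (w : symSub n) (t : ℝ) :
    HasDerivAt (fun s : ℝ => sqrtMat P * (NormedSpace.exp (s • (w : Mat n)) * w) * sqrtMat P)
      (sqrtMat P * (NormedSpace.exp (t • (w : Mat n)) * w * w) * sqrtMat P) t :=
  (((hasDerivAt_exp_smul (w : Mat n) t).mul_const _).const_mul (sqrtMat P)).mul_const (sqrtMat P)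

theorem aiRay_inv (P : SPD n) (X : Mat n) :
    (sqrtMat P * NormedSpace.exp X * sqrtMat P)⁻¹ =
      invSqrtMat P * NormedSpace.exp (-X) * invSqrtMat P := by
  refine Matrix.inv_eq_right_inv ?_
  calc sqrtMat P * NormedSpace.exp X * sqrtMat P *
        (invSqrtMat P * NormedSpace.exp (-X) * invSqrtMat P)
      = sqrtMat P * NormedSpace.exp X * (sqrtMat P * invSqrtMat P) * NormedSpace.exp (-X)
          * invSqrtMat P := by simp only [mul_assoc]
    _ = sqrtMat P * (NormedSpace.exp X * NormedSpace.exp (-X)) * invSqrtMat P := by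
        rw [sqrtMat_mul_inv, mul_one]; simp only [mul_assoc]
    _ = 1 := by rw [exp_mul_exp_neg, mul_one, sqrtMat_mul_inv]

theorem isGeodesic_aiRay {β : ℝ} (hβ : 0 < 1 + n * β) (P : SPD n) (w : symSub n) :
    IsGeodesic (aiMetric β) (fun t : I => aiExp P ((t : ℝ) • w)) := by
  have hd := differentiableOn_extCurve_of_eq (aiExp_ray P w) (hasDerivAt_aiRay P w)
  have hv : ∀ t ∈ Icc (0 : ℝ) 1, velocity (fun t : I => aiExp P ((t : ℝ) • w)) t = _ :=
    fun t ht => velocity_of_eq (aiExp_ray P w) (hasDerivAt_aiRay P w) ht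
  have hvd := differentiableOn_velocity_of_eq (aiExp_ray P w) (hasDerivAt_aiRay P w)
    (fun t => (hasDerivAt_aiRay_velocity P w t).differentiableAt)
  refine ⟨hd, (isParallel_ai_iff hβ hd hvd fun t ht => velocity_isSymm hd ht).mpr fun t ht => ?_⟩
  rw [((hasDerivAt_aiRay_velocity P w t).hasDerivWithinAt.congr hv (hv t ht)).derivWithin
    (uniqueDiff_I ht), hv t ht, extCurve_of_mem _ ht]
  change _ = (1 / 2 : ℝ) • (_ * (sqrtMat P * NormedSpace.exp (t • (w : Mat n)) * sqrtMat P)⁻¹ * _ +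
    _ * (sqrtMat P * NormedSpace.exp (t • (w : Mat n)) * sqrtMat P)⁻¹ * _)
  -- With `V` the velocity both summands coincide, and the equation reads `c'' = c' c⁻¹ c'`.
  rw [aiRay_inv, ← two_smul ℝ (_ * _), smul_smul]
  norm_num
  have hcomm : (w : Mat n) * NormedSpace.exp (-(t • (w : Mat n))) =
      NormedSpace.exp (-(t • (w : Mat n))) * w :=
    (((Commute.refl (w : Mat n)).smul_right t).neg_right.exp_right).eq
  symm
  calc sqrtMat P * (NormedSpace.exp (t • (w : Mat n)) * w) * sqrtMat P *
        (invSqrtMat P * NormedSpace.exp (-(t • (w : Mat n))) * invSqrtMat P) *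
        (sqrtMat P * (NormedSpace.exp (t • (w : Mat n)) * w) * sqrtMat P)
      = sqrtMat P * NormedSpace.exp (t • (w : Mat n)) * w * (sqrtMat P * invSqrtMat P) *
          NormedSpace.exp (-(t • (w : Mat n))) * (invSqrtMat P * sqrtMat P) *
          NormedSpace.exp (t • (w : Mat n)) * w * sqrtMat P := by simp only [mul_assoc]
    _ = sqrtMat P * NormedSpace.exp (t • (w : Mat n)) * (w * NormedSpace.exp (-(t • (w : Mat n)))) *
          NormedSpace.exp (t • (w : Mat n)) * w * sqrtMat P := by
        rw [sqrtMat_mul_inv, invSqrtMat_mul]; simp only [mul_assoc, mul_one]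
    _ = sqrtMat P * (NormedSpace.exp (t • (w : Mat n)) * NormedSpace.exp (-(t • (w : Mat n)))) * w *
          NormedSpace.exp (t • (w : Mat n)) * w * sqrtMat P := by
        rw [hcomm]; simp only [mul_assoc]
    _ = sqrtMat P * (w * NormedSpace.exp (t • (w : Mat n))) * w * sqrtMat P := by
        rw [exp_mul_exp_neg, mul_one]; simp only [mul_assoc]
    _ = _ := by
        rw [(((Commute.refl (w : Mat n)).smul_right t).exp_right).eq]; simp only [mul_assoc]

/-- Two constants of motion: the geodesic equation makes `A = c⁻¹ c'` constant, and then `c' = c A`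
makes `c exp(-tA)` constant. -/
theorem eq_mul_exp_of_isGeodesic_ai {β : ℝ} (hβ : 0 < 1 + n * β) {c : I → SPD n}
    (hc : IsGeodesic (aiMetric β) c) : ∀ t ∈ Icc (0 : ℝ) 1, extCurve c t =
      extCurve c 0 * NormedSpace.exp (t • ((extCurve c 0)⁻¹ * velocity c 0)) := by
  obtain ⟨hd, hp⟩ := hc
  have hode := (isParallel_ai_iff hβ hd hp.2.1 hp.1).mp hp
  have hu : ∀ t, IsUnit (extCurve c t).det := fun t => isUnit_det_of_posDef (extCurve_posDef c t)
  have hconst := eq_of_hasDerivWithinAt_zero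
    (f := fun t => (extCurve c t)⁻¹ * velocity c t) fun t ht => by
      have h1 := (hasDerivWithinAt_inv (hasDerivWithinAt_extCurve hd ht) (hu t)).mul
        (hp.2.1 t ht).hasDerivWithinAt
      rw [hode t ht, ← two_smul ℝ (_ * _), smul_smul] at h1
      norm_num at h1
      have h2 : -((extCurve c t)⁻¹ * velocity c t * (extCurve c t)⁻¹ * velocity c t) +
          (extCurve c t)⁻¹ * (velocity c t * (extCurve c t)⁻¹ * velocity c t) = 0 := by
        simp only [mul_assoc]; exact neg_add_cancel _
      rw [h2] at h1
      exact h1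
  set A := (extCurve c 0)⁻¹ * velocity c 0 with hA
  have hvel : ∀ t ∈ Icc (0 : ℝ) 1, velocity c t = extCurve c t * A := fun t ht => by
    rw [← hconst t ht, ← mul_assoc, Matrix.mul_nonsing_inv _ (hu t), one_mul]
  have hexp : ∀ t : ℝ, HasDerivAt (fun s : ℝ => NormedSpace.exp (s • -A))
      (NormedSpace.exp (t • -A) * -A) t := hasDerivAt_exp_smul (-A)
  have hcon2 := eq_of_hasDerivWithinAt_zero
    (f := fun t => extCurve c t * NormedSpace.exp (t • -A)) fun t ht => by
      have h1 := (hasDerivWithinAt_extCurve hd ht).mul (hexp t).hasDerivWithinAt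
      have h2 : velocity c t * NormedSpace.exp (t • -A) +
          extCurve c t * (NormedSpace.exp (t • -A) * -A) = 0 := by
        have h3 : NormedSpace.exp (t • -A) * -A = -(A * NormedSpace.exp (t • -A)) := by
          rw [mul_neg, (((Commute.refl A).neg_right.smul_right t).exp_right).eq]
        rw [hvel t ht, h3, mul_neg, mul_assoc, add_neg_cancel]
      rw [h2] at h1
      exact h1
  intro t ht
  have h1 := hcon2 t ht
  simp only [zero_smul, neg_zero, NormedSpace.exp_zero, mul_one, smul_neg] at h1
  rw [← h1, mul_assoc, exp_neg_mul_exp, mul_one]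

theorem eq_aiRay {β : ℝ} (hβ : 0 < 1 + n * β) {c : I → SPD n} (hc : IsGeodesic (aiMetric β) c) :
    ∃ P w, c = fun t : I => aiExp P ((t : ℝ) • w) := by
  have hv := velocity_isSymm hc.1 zero_mem_I
  refine ⟨c 0, ⟨invSqrtMat (c 0) * velocity c 0 * invSqrtMat (c 0),
    sandwich_isSymm (invSqrtMat_isSymm _) hv⟩, funext fun t => Subtype.ext ?_⟩
  have h1 := eq_mul_exp_of_isGeodesic_ai hβ hc t t.2
  rw [extCurve_of_mem c t.2, extCurve_zero] at h1
  rw [aiExp_ray]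
  set R := sqrtMat (c 0) with hR
  set S := invSqrtMat (c 0) with hS
  have hRS : R * S = 1 := sqrtMat_mul_inv _
  have hSR : S * R = 1 := invSqrtMat_mul _
  have hSinv : S⁻¹ = R := Matrix.inv_eq_right_inv hSR
  have hcR : ((c 0 : SPD n) : Mat n) = R * R := (sqrtMat_mul_self _).symm
  have hcinv : ((c 0 : SPD n) : Mat n)⁻¹ = S * S := by
    rw [hcR]; refine Matrix.inv_eq_right_inv ?_
    rw [mul_assoc, ← mul_assoc R S, hRS, one_mul, hRS]
  -- Conjugation by `S = P^{-1/2}` makes the exponent symmetric and turns `P exp(t P⁻¹ v)` into the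
  -- symmetric form of `aiExp`.
  have h2 : (t : ℝ) • (((c 0 : SPD n) : Mat n)⁻¹ * velocity c 0) =
      S * ((t : ℝ) • (S * velocity c 0 * S)) * S⁻¹ := by
    rw [hcinv, hSinv, Matrix.mul_smul, Matrix.smul_mul]
    congr 1
    calc S * S * velocity c 0 = S * S * velocity c 0 * (S * R) := by rw [hSR, mul_one]
      _ = _ := by simp only [mul_assoc]
  rw [h2, Matrix.exp_conj _ _ (isUnit_invSqrtMat _), hSinv, hcR] at h1
  refine h1.trans ?_
  calc R * R * (S * NormedSpace.exp ((t : ℝ) • (S * velocity c 0 * S)) * R)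
      = R * (R * S) * NormedSpace.exp ((t : ℝ) • (S * velocity c 0 * S)) * R := by
        simp only [mul_assoc]
    _ = _ := by rw [hRS, mul_one]

/-! ### Affine-invariant parallel transport from the identity -/

theorem matLog_one : matLog (1 : Mat n) = 0 := by
  have := matLog_exp (X := (0 : Mat n)) Matrix.isSymm_zero
  rwa [NormedSpace.exp_zero] at this

theorem sqrtMat_one : sqrtMat (1 : SPD n) = 1 := by
  rw [sqrtMat, matPow_eq, show ((1 : SPD n) : Mat n) = 1 from rfl, matLog_one, smul_zero,
    NormedSpace.exp_zero]

theorem coe_aiExp_one (w : symSub n) : (aiExp 1 w : Mat n) = NormedSpace.exp (w : Mat n) := by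
  rw [coe_aiExp, sqrtMat_one, one_mul, mul_one]

theorem sqrtMat_aiExp_one (w : symSub n) :
    sqrtMat (aiExp 1 w) = NormedSpace.exp ((1 / 2 : ℝ) • (w : Mat n)) := by
  rw [sqrtMat, coe_aiExp_one, matPow_exp w.2]

theorem aiRay_one (w : symSub n) (t : I) :
    (aiExp 1 ((t : ℝ) • w) : Mat n) = NormedSpace.exp ((t : ℝ) • (w : Mat n)) :=
  coe_aiExp_one _

/-- Along a ray from the identity `c = exp(tw)` commutes with `w`, so `c' c⁻¹ = c⁻¹ c' = w` and the
transport equation has constant coefficients. -/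
theorem isParallel_ai_one_iff {β : ℝ} (hβ : 0 < 1 + n * β) (w : symSub n) {V : ℝ → Mat n}
    (hV : DifferentiableOn ℝ V (Icc 0 1)) (hs : ∀ t ∈ Icc (0 : ℝ) 1, (V t).IsSymm) :
    IsParallel (aiMetric β) (fun t : I => aiExp 1 ((t : ℝ) • w)) V ↔ ∀ t ∈ Icc (0 : ℝ) 1,
      derivWithin V (Icc 0 1) t = (1 / 2 : ℝ) • ((w : Mat n) * V t + V t * w) := by
  have hdv := hasDerivAt_exp_smul (w : Mat n)
  rw [isParallel_ai_iff hβ (differentiableOn_extCurve_of_eq (aiRay_one w) hdv) hV hs]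
  refine forall₂_congr fun t ht => ?_
  rw [velocity_of_eq (aiRay_one w) hdv ht, extCurve_of_mem _ ht, aiRay_one w ⟨t, ht⟩,
    ← Matrix.exp_neg]
  have h1 : NormedSpace.exp (t • (w : Mat n)) * w = w * NormedSpace.exp (t • (w : Mat n)) :=
    ((((Commute.refl (w : Mat n)).smul_right t).exp_right).eq).symm
  have h2 : NormedSpace.exp (t • (w : Mat n)) * w * NormedSpace.exp (-(t • (w : Mat n))) = w := by
    rw [h1, mul_assoc, exp_mul_exp_neg, mul_one]
  have h3 : V t * NormedSpace.exp (-(t • (w : Mat n))) * (NormedSpace.exp (t • (w : Mat n)) * w) =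
      V t * w := by
    rw [mul_assoc, ← mul_assoc (NormedSpace.exp (-(t • (w : Mat n)))), exp_neg_mul_exp, one_mul]
  simp only [h2, h3]

/-- The parallel field along a geodesic from the identity. -/
def aiField (w v : symSub n) (t : ℝ) : Mat n :=
  NormedSpace.exp (t • ((1 / 2 : ℝ) • (w : Mat n))) * v *
    NormedSpace.exp (t • ((1 / 2 : ℝ) • (w : Mat n)))

theorem aiField_isSymm (w v : symSub n) (t : ℝ) : (aiField w v t).IsSymm :=
  sandwich_isSymm (exp_isSymm (Matrix.IsSymm.smul (Matrix.IsSymm.smul w.2 _) _)) v.2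

theorem hasDerivAt_aiField (w v : symSub n) (t : ℝ) : HasDerivAt (aiField w v)
    ((1 / 2 : ℝ) • ((w : Mat n) * aiField w v t + aiField w v t * w)) t := by
  have he := hasDerivAt_exp_smul ((1 / 2 : ℝ) • (w : Mat n)) t
  have h1 := (he.mul_const (v : Mat n)).mul he
  have hcomm := (((Commute.refl ((1 / 2 : ℝ) • (w : Mat n))).smul_right t).exp_right).eq
  refine h1.congr_deriv ?_
  rw [← hcomm, aiField]
  conv_lhs => rw [hcomm, ← mul_assoc _ _ ((1 / 2 : ℝ) • (w : Mat n)), ← hcomm]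
  simp only [smul_add, Matrix.smul_mul, Matrix.mul_smul, mul_assoc]

theorem isParallel_aiField {β : ℝ} (hβ : 0 < 1 + n * β) (w v : symSub n) :
    IsParallel (aiMetric β) (fun t : I => aiExp 1 ((t : ℝ) • w)) (aiField w v) := by
  rw [isParallel_ai_one_iff hβ w
    (fun t _ => (hasDerivAt_aiField w v t).differentiableAt.differentiableWithinAt)
    (fun t _ => aiField_isSymm w v t)]
  exact fun t ht => (hasDerivAt_aiField w v t).hasDerivWithinAt.derivWithin (uniqueDiff_I ht)

/-- The constant of motion is `exp(-tw/2) V exp(-tw/2)`. -/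
theorem parallel_ai_eq {β : ℝ} (hβ : 0 < 1 + n * β) (w v : symSub n) {V : ℝ → Mat n}
    (hV : IsParallel (aiMetric β) (fun t : I => aiExp 1 ((t : ℝ) • w)) V) (h0 : V 0 = v) :
    V 1 = NormedSpace.exp ((1 / 2 : ℝ) • (w : Mat n)) * v *
      NormedSpace.exp ((1 / 2 : ℝ) • (w : Mat n)) := by
  have hode := (isParallel_ai_one_iff hβ w hV.2.1 hV.1).mp hV
  set h : Mat n := (1 / 2 : ℝ) • (w : Mat n) with hh
  have he : ∀ t : ℝ, HasDerivAt (fun s : ℝ => NormedSpace.exp (s • -h))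
      (NormedSpace.exp (t • -h) * -h) t := hasDerivAt_exp_smul (-h)
  have hconst := eq_of_hasDerivWithinAt_zero
    (f := fun t => NormedSpace.exp (t • -h) * V t * NormedSpace.exp (t • -h)) fun t ht => by
      have h1 := ((he t).hasDerivWithinAt.mul (hV.2.1 t ht).hasDerivWithinAt).mul
        (he t).hasDerivWithinAt
      have hw : (1 / 2 : ℝ) • ((w : Mat n) * V t + V t * w) = h * V t + V t * h := by
        rw [hh, smul_add, Matrix.smul_mul, Matrix.mul_smul]
      have hcomm : NormedSpace.exp (t • -h) * h = h * NormedSpace.exp (t • -h) :=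
        (((Commute.refl h).neg_right.smul_right t).exp_right).eq.symm
      rw [hode t ht, hw] at h1
      refine h1.congr_deriv ?_
      change (NormedSpace.exp (t • -h) * -h * V t + NormedSpace.exp (t • -h) *
        (h * V t + V t * h)) * NormedSpace.exp (t • -h) +
          NormedSpace.exp (t • -h) * V t * (NormedSpace.exp (t • -h) * -h) = 0
      generalize NormedSpace.exp (t • -h) = E at hcomm ⊢
      rw [show E * V t * (E * -h) = -(E * V t * h * E) by
        rw [mul_neg, mul_neg, hcomm]; simp only [mul_assoc]]
      noncomm_ring
  have h1 := hconst 1 one_mem_I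
  simp only [one_smul, zero_smul, NormedSpace.exp_zero, one_mul, mul_one, h0] at h1
  rw [← h1]
  exact (sandwich_cancel (exp_neg_mul_exp h)).symm

theorem aiExp_expFrame {β : ℝ} (hβ : 0 < 1 + n * β) :
    ExpFrame (aiMetric (n := n) β) aiExp
      (fun P (w : symSub n) => sqrtMat P * (w : Mat n) * sqrtMat P) where
  zero P := Subtype.ext (by
    rw [coe_aiExp, ZeroMemClass.coe_zero, NormedSpace.exp_zero, mul_one, sqrtMat_mul_self])
  bij P := by
    constructor
    · intro w v hwv
      have h1 := congrArg (fun Q : SPD n => invSqrtMat P * (Q : Mat n) * invSqrtMat P) hwv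
      simp only [coe_aiExp, sandwich_cancel (sqrtMat_mul_inv P)] at h1
      exact Subtype.ext (by rw [← matLog_exp w.2, h1, matLog_exp v.2])
    · intro Q
      refine ⟨⟨matLog (invSqrtMat P * (Q : Mat n) * invSqrtMat P), matLog_isSymm _⟩,
        Subtype.ext ?_⟩
      rw [coe_aiExp, exp_matLog (congr_posDef (invSqrtMat_isSymm P) (isUnit_invSqrtMat P) Q.2),
        sandwich_cancel (invSqrtMat_mul P)]
  geod := isGeodesic_aiRay hβ
  geod_eq _ hc := eq_aiRay hβ hc
  vel P w := by
    rw [velocity_of_eq (aiExp_ray P w) (hasDerivAt_aiRay P w) zero_mem_I, zero_smul,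
      NormedSpace.exp_zero, one_mul]
  inj P w v hwv := by
    have h1 := congrArg (fun Q : Mat n => invSqrtMat P * Q * invSqrtMat P) hwv
    simp only [sandwich_cancel (sqrtMat_mul_inv P)] at h1
    exact Subtype.ext h1
  parallel w v := ⟨_, isParallel_aiField hβ w v, by simp [aiField, sqrtMat_one]⟩
  parallel_eq w v V hV h0 := by
    rw [sqrtMat_one, one_mul, mul_one] at h0
    rw [sqrtMat_aiExp_one]
    exact parallel_ai_eq hβ w v hV h0
  smul s w := by simp
  metric_smul := aiMetric_smul β 1
  metric_pos w hw := by
    rw [sqrtMat_one, one_mul, mul_one]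
    exact aiMetric_one_pos hβ w.2 fun h => hw (Subtype.ext h)
  -- The square root of `exp w` is `exp (w/2)`, so sandwiching by `exp (-w/2)` undoes gyroaddition
  -- of `exp w`.
  cancel w v u huv := by
    have h1 := congrArg (fun Q : SPD n => (Q : Mat n)) huv
    simp only [coe_aiExp, sqrtMat_aiExp_one, sqrtMat_one, one_mul, mul_one] at h1
    refine Subtype.ext ?_
    rw [coe_aiExp, sqrtMat_aiExp_one, coe_aiExp_one, ← h1, NegMemClass.coe_neg, smul_neg]
    exact sandwich_cancel (exp_mul_exp_neg _)

/-! ### Affine-invariant operations as congruences, and the frames of all the metrics -/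

theorem matLog_aiExp_one (w : symSub n) : matLog (aiExp 1 w : Mat n) = w := by
  rw [coe_aiExp_one, matLog_exp w.2]

theorem aiExp_log {β : ℝ} (hβ : 0 < 1 + n * β) (P Q : SPD n) :
    aiExp P ((aiExp_expFrame hβ).log 1 Q) = spdCongr P (1 / 2) Q := by
  have h1 := congrArg (fun Q : SPD n => (Q : Mat n)) ((aiExp_expFrame hβ).e_log 1 Q)
  simp only [coe_aiExp_one] at h1
  rw [aiExp]
  congr 1
  exact Subtype.ext h1

theorem gyroAdd_ai {β : ℝ} (hβ : 0 < 1 + n * β) (P Q : SPD n) :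
    gyroAdd (aiMetric β) P Q = spdCongr P (1 / 2) Q := by
  rw [(aiExp_expFrame hβ).gyroAdd_eq, aiExp_log hβ]

theorem phi_ai {β : ℝ} (hβ : 0 < 1 + n * β) (P Q : SPD n) :
    phi (aiMetric β) P Q = spdCongr P (-(1 / 2)) Q := by
  have h := aiExp_expFrame (n := n) hβ
  rw [phi, gyroAdd_ai hβ, h.gyroNeg_eq]
  refine Subtype.ext ?_
  have h1 : matLog (P : Mat n) = (h.log 1 P : symSub n) := by
    conv_lhs => rw [← h.e_log 1 P]
    exact matLog_aiExp_one _
  change matPow (aiExp 1 (-h.log 1 P) : Mat n) (1 / 2) * (Q : Mat n) *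
    matPow (aiExp 1 (-h.log 1 P) : Mat n) (1 / 2) =
    matPow (P : Mat n) (-(1 / 2)) * (Q : Mat n) * matPow (P : Mat n) (-(1 / 2))
  rw [matPow_eq (aiExp 1 _), matPow_eq P, matLog_aiExp_one, h1]
  simp

/-- The map `aiExp` and hence its inverse do not involve `β`, so the geodesics are those of `β = 0`.
-/
theorem geodesicPoint_ai {β : ℝ} (hβ : 0 < 1 + n * β) :
    geodesicPoint (aiMetric (n := n) β) = geodesicPoint (aiMetric 0) := by
  have h0 : (0 : ℝ) < 1 + n * 0 := by norm_num
  funext P Q t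
  rw [(aiExp_expFrame hβ).geodesicPoint_eq, (aiExp_expFrame h0).geodesicPoint_eq]
  congr 2

theorem proposedBN_eq_affineBN {β : ℝ} (hβ : 0 < 1 + n * β) {α : SPD n → SPD n → I → I}
    (hα : ∀ x y : SPD n, SolvesAlmostGeodesicEq (aiMetric β) x y (α x y)) :
    proposedBN (aiMetric β) α = affineBN := by
  rw [(aiExp_expFrame hβ).proposedBN_eq hα]
  ext1
  · funext m x
    exact phi_ai hβ m x
  · funext b x
    exact gyroAdd_ai hβ b x
  · exact geodesicPoint_ai hβ

theorem IsGyroMetric.exists_expFrame {g : Metric n} (hg : IsGyroMetric g) :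
    ∃ (W : Submodule ℝ (Mat n)) (e : SPD n → W → SPD n) (τ : SPD n → W → Mat n),
      ExpFrame g e τ := by
  cases hg with
  | ai β hβ => exact ⟨_, _, _, aiExp_expFrame hβ⟩
  | le => exact ⟨_, _, _, leMetric_flatChart.expFrame leMetric_smul⟩
  | lc => exact ⟨_, _, _, lcMetric_flatChart.expFrame lcMetric_smul⟩

end SPDGyro

end

open SPDGyro in
theorem proposition4p1 (n : ℕ) (g : Metric n) (hg : IsGyroMetric g) :
    -- the automorphisms `φ_x` are bijections with `φ_x(x) = 1` and inverse `x ⊕ ·`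
    (∀ x : SPD n, phi g x x = 1 ∧ Function.Bijective (phi g x) ∧
      ∀ y : SPD n, phiInv g x y = gyroAdd g x y) ∧
    -- `α(t) = t` is a solution, and the only one when `x ≠ y`
    (∀ x y : SPD n, SolvesAlmostGeodesicEq g x y (fun t => t)) ∧
    (∀ x y : SPD n, x ≠ y → ∀ α : unitInterval → unitInterval,
      SolvesAlmostGeodesicEq g x y α → α = fun t => t) ∧
    -- the almost geodesic is `x ⊕ t ⊗ (⊖ x ⊕ y)`, and is the unique geodesic joining `x` to `y`
    (∀ x y : SPD n, ∀ α : unitInterval → unitInterval, SolvesAlmostGeodesicEq g x y α →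
      (∀ t : unitInterval, almostGeodesic g x y α t =
        gyroAdd g x (gyroSmul g t (gyroAdd g (gyroNeg g x) y))) ∧
      ∀ c : unitInterval → SPD n, IsGeodesicJoining g x y c ↔ c = almostGeodesic g x y α) ∧
    -- the proposed layer has the same operations as the existing layers
    (∀ α : SPD n → SPD n → unitInterval → unitInterval,
      (∀ x y : SPD n, SolvesAlmostGeodesicEq g x y (α x y)) →
      proposedBN g α = gyroBN g ∧
      ∀ β : ℝ, 0 < 1 + n * β → g = aiMetric β → proposedBN g α = affineBN) := by
  obtain ⟨W, e, τ, h⟩ := hg.exists_expFrame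
  refine ⟨fun x => ⟨h.phi_self x, h.phi_bijective x, h.phiInv_eq x⟩,
    fun x y => (h.solves_iff x y _).mpr fun _ => rfl, fun x y hxy α hα => h.solves_unique hxy hα,
    fun x y α hα => ⟨h.almostGeodesic_eq hα, fun c => ?_⟩,
    fun α hα => ⟨h.proposedBN_eq hα, fun β hβ hgβ => ?_⟩⟩
  · rw [h.isGeodesicJoining_iff, h.almostGeodesic_eq' hα]
  · subst hgβ
    exact proposedBN_eq_affineBN hβ hα
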